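/- **Setting.** Let $X$ be a topological space with a good cover $\mathcal U=\{U_i\}_{i\in I}$, i.e. the $U_i$ are open, cover $X$, and every nonempty finite intersection of members of $\mathcal U$ is contractible. The nerve $N(\mathcal U)$ is the simplicial complex whose simplices are the nonempty finite sets $J\subseteq I$ with $\bigcap_{j\in J}U_j\neq\emptyset$; fix a total order on $I$ and orient its simplices by it, so that $H_1(N(\mathcal U);A)$ is computed from chains $\sum_k\sigma_k\otimes a_k$ on edges $\sigma=ij$, $i<j$. The edge groupoid $\mathcal E N(\mathcal U)$ has the vertices of $N(\mathcal U)$ as objects and edge paths modulo elementary contractions ($uvw\mapsto uw$ when $u,v,w$ span a simplex, $uu\mapsto u$) as morphisms; $[ij]$ is the class of the edge path $ij$. Let $f:X\to Y$ be continuous, and let $p:\tilde Y\to Y$ be a universal covering with group $\Gamma$: $\tilde Y$ is simply connected, the discrete group $\Gamma$ acts on $\tilde Y$ by a covering space action (every point has a neighbourhood $V$ with $gV\cap V=\emptyset$ for all $g\ne e$), and $p$ is the quotient map of this action. Let $f^*p:\tilde X=\{(x,\tilde y): f(x)=p(\tilde y)\}\to X$ be the induced covering, on which $\Gamma$ acts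 by $g(x,\tilde y)=(x,g\tilde y)$. An atlas of $f^*p$ over $\mathcal U$ is a family of homeomorphisms $\varphi_i:(f^*p)^{-1}(U_i)\to U_i\times\Gamma$ over $U_i$ with $\varphi_i(hz)=h\varphi_i(z)$, where $h(x,g)=(x,hg)$. A transition homomorphism of the atlas is a groupoid homomorphism $t:\mathcal E N(\mathcal U)\to\Gamma$ such that $\varphi_j\varphi_i^{-1}(x,g)=(x,g\,t([ij]))$ for all vertices $i,j$ with $U_i\cap U_j\ne\emptyset$, all $x\in U_i\cap U_j$ and all $g\in\Gamma$. Write $\mathrm{ab}:\Gamma\to\Gamma^{\mathrm{ab}}$ for the abelianisation. For a set-theoretic section $\lambda:Y\to\tilde Y$ of $p$ and a path $\gamma$ from $x$ to $y$ in $Y$, let $\mu_\lambda([\gamma])\in\Gamma$ be the element such that the lift of $\gamma$ starting at $\lambda(x)$ ends at $\mu_\lambda([\gamma])\cdot\lambda(y)$. **Statement.** Let $t$ be a transition homomorphism of an atlas of $f^*p$ over $\mathcal U$, and let $A$ be an abelian group. Then there is a well-defined group homomorphism $$\tau:H_1(N(\mathcal U);A)\to\Gamma^{\mathrm{ab}}\otimes_{\mathbb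 Z} A,\qquad \tau\Big[\sum_k\sigma_k\otimes a_k\Big]=\sum_k \mathrm{ab}(t([\sigma_k]))\otimes a_k ,$$ and there are isomorphisms $$\Phi:H_1(N(\mathcal U);A)\xrightarrow{\ \cong\ }H_1(X;A),\qquad \Psi:H_1(Y;A)\xrightarrow{\ \cong\ }\Gamma^{\mathrm{ab}}\otimes_{\mathbb Z} A$$ (singular homology of $X$ and $Y$) such that $\tau=\Psi\circ H_1(f)\circ\Phi$. The isomorphisms are the following ones, and depend on no choices: * for every choice of points $r(i)\in U_i$ (for the vertices $i$ of the nerve) and, for every edge $ij$ with $i<j$, of a path $\gamma_{ij}$ in $U_i\cup U_j$ from $r(i)$ to $r(j)$, one has $\Phi\big[\sum_k i_kj_k\otimes a_k\big]=\big[\sum_k\gamma_{i_kj_k}\otimes a_k\big]$; * for every set-theoretic section $\lambda$ of $p$, one has $\Psi\big[\sum_k\sigma_k\otimes a_k\big]=\sum_k\mathrm{ab}(\mu_\lambda([\sigma_k]))\otimes a_k$ for every singular $1$-cycle $\sum_k\sigma_k\otimes a_k$ of $Y$. -/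

import Mathlib

open CategoryTheory
open scoped TensorProduct

universe u v w

namespace NerveMonodromy

/-! ### Groups as groupoids with one object -/

/-- The unique object of a group regarded as a groupoid. -/
structure Deloop (G : Type u) : Type where

namespace Deloop

/-- A group as a one-object groupoid; composition "first `g`, then `h`" is the product `g * h`. -/
instance instGroupoid (G : Type u) [Group G] : Groupoid.{u} (Deloop G) where
  Hom _ _ := G
  id _ := 1
  comp g h := g * h
  id_comp := one_mul
  comp_id := mul_one
  assoc := mul_assoc
  inv g := g⁻¹
  inv_comp := inv_mul_cancel
  comp_inv := mul_inv_cancel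

/-- The group element underlying a morphism. -/
def elt {G : Type u} [Group G] {a b : Deloop G} (g : a ⟶ b) : G := g

end Deloop

/-! ### The edge groupoid of a simplicial complex -/

section EdgeGroupoid

variable {ι : Type u} [DecidableEq ι]

/-- The vertices of a simplicial complex. -/
@[ext]
structure Vertex (K : PreAbstractSimplicialComplex ι) : Type u where
  val : ι
  mem : {val} ∈ K

/-- There is an arrow from `a` to `b` when `a = b` or `ab` is an edge. -/
instance Vertex.instQuiver (K : PreAbstractSimplicialComplex ι) : Quiver.{0} (Vertex K) where
  Hom a b := PLift (({a.val, b.val} : Finset ι) ∈ K)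

/-- The edge path with the two vertices `a`, `b`. -/
def edgePath {K : PreAbstractSimplicialComplex ι} {a b : Vertex K}
    (h : ({a.val, b.val} : Finset ι) ∈ K) :
    (Paths.of (Vertex K)).obj a ⟶ (Paths.of (Vertex K)).obj b :=
  (Paths.of (Vertex K)).map (PLift.up h)

/-- Elementary contractions of edge paths: `abc` contracts to `ac` when the three vertices span a
simplex, and `aa` contracts to the constant edge path at `a`. -/
inductive EdgeContraction (K : PreAbstractSimplicialComplex ι) : HomRel (Paths (Vertex K))
  | triangle {a b c : Vertex K} (hab : ({a.val, b.val} : Finset ι) ∈ K)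
      (hbc : ({b.val, c.val} : Finset ι) ∈ K) (hac : ({a.val, c.val} : Finset ι) ∈ K)
      (habc : ({a.val, b.val, c.val} : Finset ι) ∈ K) :
      EdgeContraction K (edgePath hab ≫ edgePath hbc) (edgePath hac)
  | const {a : Vertex K} (haa : ({a.val, a.val} : Finset ι) ∈ K) :
      EdgeContraction K (edgePath haa) (𝟙 ((Paths.of (Vertex K)).obj a))

/-- The edge groupoid: objects are vertices, morphisms are edge paths modulo the congruence
generated by elementary contractions. -/
def EdgeGroupoid (K : PreAbstractSimplicialComplex ι) : Type u :=
  CategoryTheory.Quotient (EdgeContraction K)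

namespace EdgeGroupoid

instance instCategory (K : PreAbstractSimplicialComplex ι) : Category (EdgeGroupoid K) :=
  inferInstanceAs (Category (CategoryTheory.Quotient (EdgeContraction K)))

/-- The functor sending an edge path to its edge homotopy class. -/
def mk (K : PreAbstractSimplicialComplex ι) : Paths (Vertex K) ⥤ EdgeGroupoid K :=
  CategoryTheory.Quotient.functor (EdgeContraction K)

/-- A vertex as an object of the edge groupoid. -/
def obj {K : PreAbstractSimplicialComplex ι} (a : Vertex K) : EdgeGroupoid K :=
  (mk K).obj ((Paths.of (Vertex K)).obj a)

/-- The edge homotopy class `[ab]`. -/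
def edge {K : PreAbstractSimplicialComplex ι} {a b : Vertex K}
    (h : ({a.val, b.val} : Finset ι) ∈ K) : obj a ⟶ obj b :=
  (mk K).map (edgePath h)

lemma edge_comp_edge {K : PreAbstractSimplicialComplex ι} {a b c : Vertex K}
    (hab : ({a.val, b.val} : Finset ι) ∈ K) (hbc : ({b.val, c.val} : Finset ι) ∈ K)
    (hac : ({a.val, c.val} : Finset ι) ∈ K)
    (habc : ({a.val, b.val, c.val} : Finset ι) ∈ K) :
    edge hab ≫ edge hbc = edge hac :=
  ((mk K).map_comp _ _).symm.trans
    (CategoryTheory.Quotient.sound _ (.triangle hab hbc hac habc))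

lemma edge_self {K : PreAbstractSimplicialComplex ι} {a : Vertex K}
    (haa : ({a.val, a.val} : Finset ι) ∈ K) : edge haa = 𝟙 (obj a) :=
  (CategoryTheory.Quotient.sound _ (.const haa)).trans ((mk K).map_id _)

lemma isIso_edge {K : PreAbstractSimplicialComplex ι} {a b : Vertex K}
    (h : ({a.val, b.val} : Finset ι) ∈ K) : IsIso (edge h) := by
  have h' : ({b.val, a.val} : Finset ι) ∈ K := by rwa [Finset.pair_comm]
  have ha : ({a.val, a.val} : Finset ι) ∈ K := by simpa using a.mem
  have hb : ({b.val, b.val} : Finset ι) ∈ K := by simpa using b.mem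
  refine ⟨edge h', ?_, ?_⟩
  · rw [edge_comp_edge h h' ha (by simpa [Finset.pair_comm] using h), edge_self]
  · rw [edge_comp_edge h' h hb (by simpa [Finset.pair_comm] using h), edge_self]

lemma isIso_mk_map {K : PreAbstractSimplicialComplex ι} {a b : Vertex K} (f : Quiver.Path a b) :
    IsIso ((mk K).map (X := (Paths.of (Vertex K)).obj a) (Y := (Paths.of (Vertex K)).obj b) f) := by
  induction f with
  | nil =>
    exact (IsIso.id (obj a) : IsIso (𝟙 (obj a)))
  | @cons c d p e ih =>
    have h2 : IsIso (edge e.down) := isIso_edge e.down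
    exact (IsIso.comp_isIso' ih h2 : IsIso (_ ≫ edge e.down))

/-- Every morphism of the edge groupoid is invertible. -/
instance instIsGroupoid (K : PreAbstractSimplicialComplex ι) : IsGroupoid (EdgeGroupoid K) where
  all_isIso f := by
    obtain ⟨f, rfl⟩ := Quot.exists_rep f
    exact isIso_mk_map f

end EdgeGroupoid

end EdgeGroupoid

/-! ### Simplicial homology in degree one -/

section SimplicialHomology

variable {ι : Type u} [LinearOrder ι]

/-- The `n`-simplices of a simplicial complex, with vertices listed increasingly. -/
def Simplex (K : PreAbstractSimplicialComplex ι) (n : ℕ) : Type u :=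
  {s : Fin (n + 1) ↪o ι // Finset.univ.map s.toEmbedding ∈ K}

/-- A nonempty set of vertices of a simplex is a simplex. -/
lemma Simplex.mem_of_subset {K : PreAbstractSimplicialComplex ι} {n : ℕ} (s : Simplex K n)
    {t : Finset ι} (ht : t ⊆ Finset.univ.map s.1.toEmbedding) (hne : t.Nonempty) : t ∈ K :=
  (K.isRelLowerSet_faces s.2).2 ht hne

/-- The face of a simplex opposite to its `k`-th vertex. -/
def Simplex.face {K : PreAbstractSimplicialComplex ι} {n : ℕ} (k : Fin (n + 2))
    (s : Simplex K (n + 1)) : Simplex K n :=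
  ⟨(Fin.succAboveOrderEmb k).trans s.1, s.mem_of_subset
    (by
      intro x hx
      obtain ⟨i, -, rfl⟩ := Finset.mem_map.mp hx
      exact Finset.mem_map.mpr ⟨k.succAbove i, Finset.mem_univ _, rfl⟩)
    (Finset.univ_nonempty.map)⟩

/-- The first vertex of an edge. -/
def Simplex.src {K : PreAbstractSimplicialComplex ι} (e : Simplex K 1) : Vertex K :=
  ⟨e.1 0, e.mem_of_subset (by simp) (by simp)⟩

/-- The second vertex of an edge. -/
def Simplex.tgt {K : PreAbstractSimplicialComplex ι} (e : Simplex K 1) : Vertex K :=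
  ⟨e.1 1, e.mem_of_subset (by simp) (by simp)⟩

/-- The class of an edge in the edge groupoid. -/
def Simplex.edgeClass {K : PreAbstractSimplicialComplex ι} (e : Simplex K 1) :
    EdgeGroupoid.obj e.src ⟶ EdgeGroupoid.obj e.tgt :=
  EdgeGroupoid.edge (e.mem_of_subset
    (by intro x hx; simp only [Finset.mem_insert, Finset.mem_singleton] at hx
        rcases hx with rfl | rfl
        · exact Finset.mem_map.mpr ⟨0, Finset.mem_univ _, rfl⟩
        · exact Finset.mem_map.mpr ⟨1, Finset.mem_univ _, rfl⟩)
    (by simp))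

/-- Simplicial chains with coefficients in `A`. -/
abbrev SimplicialChain (K : PreAbstractSimplicialComplex ι) (A : Type v) [AddCommGroup A]
    (n : ℕ) : Type (max u v) :=
  Simplex K n →₀ A

/-- The simplicial boundary map, the alternating sum of the faces. -/
noncomputable def simplicialBoundary (K : PreAbstractSimplicialComplex ι) (A : Type v)
    [AddCommGroup A] (n : ℕ) : SimplicialChain K A (n + 1) →+ SimplicialChain K A n :=
  ∑ k : Fin (n + 2), (-1 : ℤ) ^ (k : ℕ) • Finsupp.mapDomain.addMonoidHom (Simplex.face k)

lemma simplicialBoundary_comp (K : PreAbstractSimplicialComplex ι) (A : Type v)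
    [AddCommGroup A] : (simplicialBoundary K A 0).comp (simplicialBoundary K A 1) = 0 := by
  have h : ∀ (i : Fin 2) (j : Fin 3) (i' : Fin 2) (j' : Fin 3),
      (∀ k : Fin 1, j.succAbove (i.succAbove k) = j'.succAbove (i'.succAbove k)) →
      ∀ s : Simplex K 2, (s.face j).face i = (s.face j').face i' := fun i j i' j' hk s =>
    Subtype.ext (RelEmbedding.ext fun k => congrArg s.1 (hk k))
  refine Finsupp.addHom_ext fun s a => ?_
  simp only [simplicialBoundary, AddMonoidHom.comp_apply, AddMonoidHom.finsetSum_apply,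
    AddMonoidHom.smul_apply, map_sum, map_zsmul, Finsupp.mapDomain.addMonoidHom_apply,
    Finsupp.mapDomain_single, AddMonoidHom.zero_apply]
  change ∑ x : Fin 3, (-1 : ℤ) ^ (x : ℕ) • ∑ y : Fin 2, (-1 : ℤ) ^ (y : ℕ) •
    Finsupp.single (Simplex.face y (Simplex.face x s)) a = 0
  simp only [Fin.sum_univ_two, Fin.sum_univ_three]
  rw [h 0 1 0 0 (by decide) s, h 0 2 1 0 (by decide) s, h 1 2 1 1 (by decide) s]
  simp
  abel

/-- Simplicial `1`-cycles. -/
noncomputable abbrev simplicialCycles (K : PreAbstractSimplicialComplex ι) (A : Type v)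
    [AddCommGroup A] : AddSubgroup (SimplicialChain K A 1) :=
  (simplicialBoundary K A 0).ker

/-- The first simplicial homology group with coefficients in `A`. -/
abbrev SimplicialH1 (K : PreAbstractSimplicialComplex ι) (A : Type v) [AddCommGroup A] :
    Type (max u v) :=
  simplicialCycles K A ⧸ (simplicialBoundary K A 1).range.addSubgroupOf (simplicialCycles K A)

end SimplicialHomology

/-! ### Singular homology in degree one -/

section SingularHomology

open scoped Simplicial

/-- Singular `1`-simplices of a space. -/
abbrev Singular1 (X : Type u) [TopologicalSpace X] : Type u :=
  (TopCat.toSSet.obj (TopCat.of X)) _⦋1⦌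

/-- A singular `1`-simplex as a path from its `0`-th to its `1`-st vertex. -/
noncomputable def Singular1.path {X : Type u} [TopologicalSpace X] (σ : Singular1 X) :
    Path (TopCat.toSSetObjEquiv _ _ σ (stdSimplexHomeomorphUnitInterval.symm 0) : X)
      (TopCat.toSSetObjEquiv _ _ σ (stdSimplexHomeomorphUnitInterval.symm 1) : X) where
  toFun s := TopCat.toSSetObjEquiv _ _ σ (stdSimplexHomeomorphUnitInterval.symm s)
  continuous_toFun := (map_continuous (TopCat.toSSetObjEquiv _ _ σ)).comp
    stdSimplexHomeomorphUnitInterval.symm.continuous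
  source' := rfl
  target' := rfl

/-- A path as a singular `1`-simplex. -/
noncomputable def Singular1.ofPath {X : Type u} [TopologicalSpace X] {x y : X} (γ : Path x y) :
    Singular1 X :=
  (TopCat.toSSetObjEquiv (TopCat.of X) (.op ⦋1⦌)).symm
    (γ.toContinuousMap.comp (stdSimplexHomeomorphUnitInterval : C(stdSimplex ℝ (Fin 2), _)))

/-- The singular chain complex with coefficients in `A`. -/
noncomputable abbrev singularComplex (X : Type u) [TopologicalSpace X] (A : Type u)
    [AddCommGroup A] : ChainComplex AddCommGrpCat.{u} ℕ :=
  ((AlgebraicTopology.singularChainComplexFunctor AddCommGrpCat.{u}).obj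
    (AddCommGrpCat.of A)).obj (TopCat.of X)

/-- The first singular homology group with coefficients in `A`. -/
noncomputable abbrev SingularH1 (X : Type u) [TopologicalSpace X] (A : Type u)
    [AddCommGroup A] : AddCommGrpCat.{u} :=
  ((AlgebraicTopology.singularHomologyFunctor AddCommGrpCat.{u} 1).obj
    (AddCommGrpCat.of A)).obj (TopCat.of X)

/-- The map induced on first singular homology by a continuous map. -/
noncomputable abbrev singularH1Map {X Y : Type u} [TopologicalSpace X] [TopologicalSpace Y]
    (A : Type u) [AddCommGroup A] (f : C(X, Y)) : SingularH1 X A ⟶ SingularH1 Y A :=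
  ((AlgebraicTopology.singularHomologyFunctor AddCommGrpCat.{u} 1).obj
    (AddCommGrpCat.of A)).map (TopCat.ofHom f)

/-- The inclusion `a ↦ σ ⊗ a` of the summand indexed by a singular `1`-simplex `σ`. -/
noncomputable def Singular1.ι {X : Type u} [TopologicalSpace X] (σ : Singular1 X) (A : Type u)
    [AddCommGroup A] : AddCommGrpCat.of A ⟶ (singularComplex X A).X 1 :=
  SSet.ιChainComplex (X := TopCat.toSSet.obj (TopCat.of X)) σ

/-- The singular `1`-chain `∑ σ, σ ⊗ c σ`. -/
noncomputable def singularChain {X : Type u} [TopologicalSpace X] {A : Type u} [AddCommGroup A]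
    (c : Singular1 X →₀ A) : ((singularComplex X A).X 1 : Type u) :=
  c.sum fun σ a => (σ.ι A).hom a

/-- The homology class of a singular `1`-cycle. -/
noncomputable def singularClass {X : Type u} [TopologicalSpace X] {A : Type u} [AddCommGroup A]
    (z : (singularComplex X A).cycles 1) : SingularH1 X A :=
  ((singularComplex X A).homologyπ 1).hom z

/-- The chain `∑ σ, σ ⊗ c σ` is a cycle and `h` is its homology class. -/
def Represents {X : Type u} [TopologicalSpace X] {A : Type u} [AddCommGroup A]
    (c : Singular1 X →₀ A) (h : SingularH1 X A) : Prop :=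
  ∃ z : (singularComplex X A).cycles 1,
    ((singularComplex X A).iCycles 1).hom z = singularChain c ∧ singularClass z = h

end SingularHomology

/-! ### Good covers and nerves -/

section Nerve

variable {X : Type u} {ι : Type v}

/-- A good cover: an open cover whose nonempty finite intersections are contractible. -/
structure IsGoodCover [TopologicalSpace X] (U : ι → Set X) : Prop where
  isOpen : ∀ i, IsOpen (U i)
  iUnion_eq : ⋃ i, U i = Set.univ
  contractible : ∀ J : Finset ι, J.Nonempty → (⋂ i ∈ J, U i).Nonempty →
    ContractibleSpace ↥(⋂ i ∈ J, U i)

/-- The nerve of a family of sets. -/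
def coverNerve (U : ι → Set X) : PreAbstractSimplicialComplex ι where
  faces := {J | J.Nonempty ∧ (⋂ i ∈ J, U i).Nonempty}
  isRelLowerSet_faces := fun _ hJ =>
    ⟨hJ.1, fun _ hJ' hne => ⟨hne, hJ.2.mono (Set.biInter_mono hJ' fun _ _ => subset_rfl)⟩⟩

end Nerve

/-! ### Monodromy, induced coverings, transition homomorphisms

A `Γ`-covering is the quotient map of a covering space action of a discrete group `Γ`, which is
Mathlib's `IsQuotientCoveringMap`. -/

section Covering

variable {X Y E : Type*} [TopologicalSpace X] [TopologicalSpace Y] [TopologicalSpace E]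
  {Γ : Type w} [Group Γ] [MulAction Γ E] {p : E → Y}

/-- The element `g` such that the lift of `γ` starting at `l x` ends at `g • l y`. -/
noncomputable def monodromyElt (hp : IsQuotientCoveringMap p Γ) (l : Y → E)
    (hl : ∀ y, p (l y) = y) {x y : Y} (γ : Path.Homotopic.Quotient x y) : Γ :=
  hp.fiberEquivGroup (⟨l y, hl y⟩ : p ⁻¹' {y})
    (hp.isCoveringMap.monodromy γ ⟨l x, hl x⟩)

/-- The total space `{(x, e) | f x = p e}` of the covering of `X` induced by `f`. -/
def InducedCovering (_ : IsQuotientCoveringMap p Γ) (f : C(X, Y)) : Type _ :=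
  {z : X × E // f z.1 = p z.2}

namespace InducedCovering

variable (hp : IsQuotientCoveringMap p Γ) (f : C(X, Y))

instance instTopologicalSpace : TopologicalSpace (InducedCovering hp f) :=
  inferInstanceAs (TopologicalSpace {z : X × E // f z.1 = p z.2})

/-- `Γ` acts on the second coordinate. -/
instance instMulAction : MulAction Γ (InducedCovering hp f) where
  smul g z := ⟨(z.1.1, g • z.1.2), z.2.trans (hp.map_smul g).symm⟩
  one_smul z := Subtype.ext (Prod.ext rfl (one_smul Γ z.1.2))
  mul_smul g h z := Subtype.ext (Prod.ext rfl (mul_smul g h z.1.2))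

/-- The induced covering map. -/
def proj (z : InducedCovering hp f) : X := z.1.1

end InducedCovering

/-- An atlas of a `Γ`-covering `q : E → X` over `U`: equivariant local trivialisations
`q ⁻¹ (U i) ≃ U i × Γ`, where `Γ` acts on `U i × Γ` by `h • (x, g) = (x, h * g)`. -/
structure EquivariantAtlas (Γ : Type w) [Group Γ] [TopologicalSpace Γ] [MulAction Γ E]
    (q : E → X) {ι : Type v} (U : ι → Set X) where
  chart : ∀ i, ↥(q ⁻¹' U i) ≃ₜ ↥(U i) × Γ
  chart_fst : ∀ i (z : ↥(q ⁻¹' U i)), ((chart i z).1 : X) = q z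
  chart_smul : ∀ i (h : Γ) (z z' : ↥(q ⁻¹' U i)), (z' : E) = h • (z : E) →
    (chart i z').2 = h * (chart i z).2

/-- `t` is the transition homomorphism of the atlas: for each edge `ab` of the nerve, the
transition map from the `a`-th chart to the `b`-th one is `(x, g) ↦ (x, g * t [ab])`. -/
def EquivariantAtlas.IsTransitionHom [TopologicalSpace Γ] {q : E → X} {ι : Type v}
    [DecidableEq ι] {U : ι → Set X} (φ : EquivariantAtlas Γ q U)
    (t : EdgeGroupoid (coverNerve U) ⥤ Deloop Γ) : Prop :=
  ∀ (a b : Vertex (coverNerve U)) (h : ({a.val, b.val} : Finset ι) ∈ coverNerve U) (x : X)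
    (ha : x ∈ U a.val) (hb : x ∈ U b.val) (g : Γ)
    (z : E) (hza : q z ∈ U a.val) (hzb : q z ∈ U b.val),
    φ.chart a.val ⟨z, hza⟩ = (⟨x, ha⟩, g) →
      φ.chart b.val ⟨z, hzb⟩ = (⟨x, hb⟩, g * Deloop.elt (t.map (EdgeGroupoid.edge h)))

end Covering

/-- The class of a group element in the abelianisation, written additively. -/
def abClass {G : Type u} [Group G] (g : G) : Additive (Abelianization G) :=
  Additive.ofMul (Abelianization.of g)

end NerveMonodromy

/-! All three maps come from one device. A path cocycle is a function on homotopy classes of paths,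
additive under concatenation. With values in Hom(A, M) it descends to singular 1-chains modulo
boundaries (`PathCocycle.lift`), because the standard triangle is simply connected. Cocycles that
differ by a potential, κ(x) - κ(y) on paths from x to y, agree on cycles
(`PathCocycle.lift_eq_of_potential`).

Let a cocycle equal k_i(x) - k_i(y) on paths inside U_i, with k_j = k_i + t_ij on overlaps for
constants t_ij. Then t determines it up to a potential (`exists_potential_of_transition_eq`), and
every t satisfying the cocycle condition arises, as the monodromy of the covering glued from the U_i
× M along t (`exists_pathCocycle_of_transition`). On a simplicial cycle of the nerve, realised by
paths in the unions U_i ∪ U_j, the cocycle evaluates to the sum of t over the edges, since the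
contributions of the vertices cancel (`PathCocycle.lift_mapDomain_ofPath`).

Φ (`IsGoodCover.exists_nerve_homology_equiv`): let t_ij be the class of the edge ij among chains of
the nerve modulo boundaries. The resulting cocycle maps H_1(X; A) to H_1 of the nerve and inverts
the realisation of simplicial cycles. It is injective because the universal cocycle of X also has
local potentials (the U_i are simply connected) with constant differences (the U_i ∩ U_j are path
connected), hence factors through it up to a potential.

Ψ (`exists_homology_equiv_abelianization`): monodromy is a cocycle with values in the
abelianisation. Another section changes it by a potential. On homology it is inverted by sending g
to the image of a path from e to g • e in the simply connected covering space.

Comparison: pulled back along f, the monodromy cocycle has as local potentials the chart coordinates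
of the section, and their transition constants are ab(t([ij])). Evaluating it on a realised
simplicial cycle gives the formula for τ. -/

namespace NerveMonodromy

/-! ### Cocycles on the fundamental groupoid -/

section PathCocycle

open unitInterval

variable {X : Type*} [TopologicalSpace X]

/-- Homotopy classes of paths which agree pointwise are identified by every function on homotopy
classes of paths. -/
lemma pathFunction_congr {α : Sort*} (P : ∀ {x y : X}, Path.Homotopic.Quotient x y → α)
    {x y x' y' : X} (γ : Path x y) (γ' : Path x' y') (h : ∀ s, γ s = γ' s) :
    P (.mk γ) = P (.mk γ') := by
  obtain rfl : x = x' := by simpa using h 0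
  obtain rfl : y = y' := by simpa using h 1
  rw [show γ = γ' from Path.ext (funext h)]

/-- A property of homotopy classes of paths which holds for small paths and is closed under
concatenation holds for all paths. -/
theorem path_induction {α : Type*} {V : α → Set X} (hV : ∀ a, IsOpen (V a))
    (P : ∀ {x y : X}, Path.Homotopic.Quotient x y → Prop)
    (loc : ∀ (a : α) {x y : X} (γ : Path x y), (∀ s, γ s ∈ V a) → P (.mk γ))
    (trans : ∀ {x y z : X} (γ : Path.Homotopic.Quotient x y) (δ : Path.Homotopic.Quotient y z),
      P γ → P δ → P (γ.trans δ))
    {x y : X} (γ : Path x y) (hγ : ∀ s, ∃ a, γ s ∈ V a) : P (.mk γ) := by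
  obtain ⟨t, t0, tm, ⟨n, hn⟩, ht⟩ := exists_monotone_Icc_subset_open_cover_unitInterval
    (fun a => (hV a).preimage γ.continuous) (fun s _ => Set.mem_iUnion.2 (hγ s))
  have key : ∀ m, P (.mk (γ.subpath 0 (t m))) := by
    intro m
    induction m with
    -- The subpath from 0 to `t 0 = 0` is constant. Constant paths are not assumed to satisfy `P`,
    -- but a constant path is small, so `loc` applies.
    | zero =>
      obtain ⟨a, ha⟩ := ht 0
      refine loc a _ fun s => ha ?_
      have : Set.Icc.convexComb 0 (t 0) s = t 0 := by rw [t0]; simp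
      change Set.Icc.convexComb 0 (t 0) s ∈ _
      rw [this]
      exact ⟨le_rfl, tm (Nat.zero_le 1)⟩
    | succ m ih =>
      obtain ⟨a, ha⟩ := ht m
      have h1 : P (.mk (γ.subpath (t m) (t (m + 1)))) := by
        refine loc a _ fun s => ?_
        have hs : γ.subpath (t m) (t (m + 1)) s ∈ Set.range (γ.subpath (t m) (t (m + 1))) :=
          ⟨s, rfl⟩
        rw [Path.range_subpath_of_le _ _ _ (tm m.le_succ)] at hs
        obtain ⟨s', hs', h⟩ := hs
        rw [← h]
        exact ha hs'
      have h2 := trans _ _ ih h1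
      rw [← Path.Homotopic.Quotient.mk_trans] at h2
      rwa [Path.Homotopic.Quotient.eq.2 ⟨Path.Homotopy.subpathTransSubpath γ 0 (t m) (t (m + 1))⟩]
        at h2
  have h := key n
  -- The subpath from 0 to 1 has endpoints `γ 0` and `γ 1`, equal to `x` and `y` only
  -- propositionally, so the comparison with `γ` is pointwise.
  rwa [hn n le_rfl, pathFunction_congr (fun q => P q) _ γ (fun s => by simp [Path.subpath])] at h

/-- A function on homotopy classes of paths with values in an abelian group which is additive under
concatenation. -/
structure PathCocycle (X : Type*) [TopologicalSpace X] (M : Type*) [AddCommGroup M] where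
  val : ∀ {x y : X}, Path.Homotopic.Quotient x y → M
  val_trans : ∀ {x y z : X} (γ : Path.Homotopic.Quotient x y) (δ : Path.Homotopic.Quotient y z),
    val (γ.trans δ) = val γ + val δ

namespace PathCocycle

variable {M : Type*} [AddCommGroup M] (h : PathCocycle X M)

/-- A cocycle with a potential on each member of an open family is given by the potential. -/
theorem val_eq_of_potential {α : Type*} {V : α → Set X} (hV : ∀ a, IsOpen (V a)) (κ : X → M)
    (loc : ∀ (a : α) {x y : X} (γ : Path x y), (∀ s, γ s ∈ V a) → h.val (.mk γ) = κ x - κ y)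
    {x y : X} (γ : Path x y) (hγ : ∀ s, ∃ a, γ s ∈ V a) : h.val (.mk γ) = κ x - κ y :=
  path_induction hV (fun {x y} q => h.val q = κ x - κ y) loc
    (fun γ δ h1 h2 => by rw [h.val_trans, h1, h2]; abel) γ hγ

/-- The value on a path in the union of two open sets with potentials that differ by a constant. -/
theorem val_eq_of_mem_union {V W : Set X} (hV : IsOpen V) (hW : IsOpen W) (k l : X → M) (t : M)
    (hk : ∀ {x y : X} (γ : Path x y), (∀ s, γ s ∈ V) → h.val (.mk γ) = k x - k y)
    (hl : ∀ {x y : X} (γ : Path x y), (∀ s, γ s ∈ W) → h.val (.mk γ) = l x - l y)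
    (ht : ∀ x ∈ V, x ∈ W → l x = k x + t)
    {x y : X} (γ : Path x y) (hγ : ∀ s, γ s ∈ V ∪ W) (hx : x ∈ V) (hy : y ∈ W) :
    h.val (.mk γ) = k x + t - l y := by
  classical
  -- The potentials `k` on `V` and `l - t` on `W` agree on the overlap, so they glue to one
  -- potential for the cover of `V ∪ W` by these two sets.
  have key := h.val_eq_of_potential (V := fun b : Bool => cond b V W)
    (by rintro (_ | _) <;> assumption)
    (fun x => if x ∈ V then k x else l x - t) ?_ γ ?_
  · rw [key, if_pos hx]
    split_ifs with h1
    · rw [ht y h1 hy]; abel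
    · abel
  · have hW' : ∀ z ∈ W, (if z ∈ V then k z else l z - t) = l z - t := by
      intro z hz
      split_ifs with h1
      · rw [ht z h1 hz]; abel
      · rfl
    rintro (_ | _) x y γ hγ
    · have h0 : x ∈ W := by simpa using hγ 0
      have h1 : y ∈ W := by simpa using hγ 1
      simp only [hW' x h0, hW' y h1, hl γ hγ]
      abel
    · have h0 : x ∈ V := by simpa using hγ 0
      have h1 : y ∈ V := by simpa using hγ 1
      rw [if_pos h0, if_pos h1, hk γ hγ]
  · intro s
    rcases hγ s with h1 | h1
    exacts [⟨true, h1⟩, ⟨false, h1⟩]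

end PathCocycle

end PathCocycle

/-! ### Singular chains as finitely supported functions -/

section SingularChains

open scoped Simplicial
open Limits

variable (S : SSet.{u}) (A : Type u) [AddCommGroup A]

/-- The boundary map on finitely supported functions on simplices. -/
noncomputable def finsuppBoundary (n : ℕ) : (S _⦋n + 1⦌ →₀ A) →+ (S _⦋n⦌ →₀ A) :=
  ∑ k : Fin (n + 2), (-1 : ℤ) ^ (k : ℕ) • Finsupp.mapDomain.addMonoidHom (S.δ k)

lemma finsuppBoundary_single (n : ℕ) (s : S _⦋n + 1⦌) (a : A) :
    finsuppBoundary S A n (Finsupp.single s a) =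
      ∑ k : Fin (n + 2), (-1 : ℤ) ^ (k : ℕ) • Finsupp.single (S.δ k s) a := by
  simp [finsuppBoundary, Finsupp.mapDomain_single]

/-- The chain given by a finitely supported function on simplices. -/
noncomputable def finsuppToChain (n : ℕ) :
    (S _⦋n⦌ →₀ A) →+ ((S.chainComplex (AddCommGrpCat.of A)).X n : Type u) :=
  Finsupp.liftAddHom fun s => (S.ιChainComplex (R := AddCommGrpCat.of A) s).hom

@[simp]
lemma finsuppToChain_single (n : ℕ) (s : S _⦋n⦌) (a : A) :
    finsuppToChain S A n (Finsupp.single s a) =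
      (S.ιChainComplex (R := AddCommGrpCat.of A) s).hom a := by
  simp [finsuppToChain]

/-- The finitely supported function on simplices given by a chain. -/
noncomputable def chainToFinsupp (n : ℕ) :
    (S.chainComplex (AddCommGrpCat.of A)).X n ⟶ AddCommGrpCat.of (S _⦋n⦌ →₀ A) :=
  Cofan.IsColimit.desc (S.isColimitChainComplexXCofan (AddCommGrpCat.of A) n)
    fun s => AddCommGrpCat.ofHom (Finsupp.singleAddHom s)

lemma ι_chainToFinsupp (n : ℕ) (s : S _⦋n⦌) :
    S.ιChainComplex s ≫ chainToFinsupp S A n = AddCommGrpCat.ofHom (Finsupp.singleAddHom s) :=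
  Cofan.IsColimit.fac (S.isColimitChainComplexXCofan (AddCommGrpCat.of A) n) _ s

/-- Chains are finitely supported functions on simplices. -/
noncomputable def chainEquiv (n : ℕ) :
    (S _⦋n⦌ →₀ A) ≃+ ((S.chainComplex (AddCommGrpCat.of A)).X n : Type u) :=
  (finsuppToChain S A n).toAddEquiv (chainToFinsupp S A n).hom
    (Finsupp.addHom_ext fun s a => by
      have := congr($(ι_chainToFinsupp S A n s).hom a)
      simpa using this)
    (by
      have : chainToFinsupp S A n ≫ AddCommGrpCat.ofHom (finsuppToChain S A n) = 𝟙 _ := by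
        refine SSet.chainComplex_hom_ext fun s => ?_
        rw [← Category.assoc, ι_chainToFinsupp]
        ext a
        simp
      exact congr($(this).hom))

lemma d_chainEquiv (n : ℕ) (c : S _⦋n + 1⦌ →₀ A) :
    ((S.chainComplex (AddCommGrpCat.of A)).d (n + 1) n).hom (chainEquiv S A (n + 1) c) =
      chainEquiv S A n (finsuppBoundary S A n c) := by
  suffices h : ((S.chainComplex (AddCommGrpCat.of A)).d (n + 1) n).hom.comp
      (chainEquiv S A (n + 1)).toAddMonoidHom =
      (chainEquiv S A n).toAddMonoidHom.comp (finsuppBoundary S A n) from congr($h c)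
  refine Finsupp.addHom_ext fun s a => ?_
  have := congr(AddCommGrpCat.homAddEquiv $(S.ιChainComplex_d (AddCommGrpCat.of A) s) a)
  simp only [map_sum, map_zsmul, AddMonoidHom.finsetSum_apply, AddMonoidHom.smul_apply] at this
  simp only [chainEquiv, AddMonoidHom.comp_apply, AddEquiv.toAddMonoidHom_eq_coe,
    AddMonoidHom.coe_coe, AddMonoidHom.toAddEquiv_apply, finsuppToChain_single,
    finsuppBoundary_single, map_sum, map_zsmul]
  exact this

end SingularChains

/-! ### Cycles and homology classes of a chain complex in degree one -/

section Cycles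

variable (K : ChainComplex AddCommGrpCat.{u} ℕ)

lemma exists_iCycles_eq (x : K.X 1) (hx : (K.d 1 0).hom x = 0) :
    ∃ z : K.cycles 1, (K.iCycles 1).hom z = x :=
  (ShortComplex.ab_exact_iff _).1
    (ShortComplex.exact_of_f_is_kernel (ShortComplex.mk _ _ (K.iCycles_d 1 0))
      (K.cyclesIsKernel 1 0 (by simp))) x hx

lemma iCycles_injective : Function.Injective (K.iCycles 1).hom :=
  (AddCommGrpCat.mono_iff_injective _).1 inferInstance

lemma homologyπ_surjective : Function.Surjective (K.homologyπ 1).hom :=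
  (AddCommGrpCat.epi_iff_surjective _).1 inferInstance

lemma homologyπ_eq_zero_iff (z : K.cycles 1) :
    (K.homologyπ 1).hom z = 0 ↔ ∃ y : K.X 2, (K.d 2 1).hom y = (K.iCycles 1).hom z := by
  have hd (y : K.X 2) : (K.iCycles 1).hom ((K.toCycles 2 1).hom y) = (K.d 2 1).hom y :=
    congr($(K.toCycles_i 2 1).hom y)
  constructor
  · intro h
    obtain ⟨y, hy⟩ := (ShortComplex.ab_exact_iff _).1
      (ShortComplex.exact_of_g_is_cokernel (ShortComplex.mk _ _ (K.toCycles_comp_homologyπ 2 1))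
        (K.homologyIsCokernel 2 1 (by simp))) z h
    exact ⟨y, by rw [← hd, ← hy]⟩
  · rintro ⟨y, hy⟩
    rw [← hd] at hy
    rw [← iCycles_injective K hy]
    exact congr($(K.toCycles_comp_homologyπ 2 1).hom y)

end Cycles

/-! ### Homology classes represented by explicit singular chains -/

section Represents

variable {X Y : Type u} [TopologicalSpace X] [TopologicalSpace Y] {A : Type u} [AddCommGroup A]

/-- The boundary of a singular chain. -/
noncomputable abbrev singularBoundary (X : Type u) [TopologicalSpace X] (A : Type u)
    [AddCommGroup A] (n : ℕ) :=
  finsuppBoundary (TopCat.toSSet.obj (TopCat.of X)) A n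

lemma singularChain_eq (c : Singular1 X →₀ A) :
    singularChain c = chainEquiv (TopCat.toSSet.obj (TopCat.of X)) A 1 c :=
  rfl

lemma d_singularChain (c : Singular1 X →₀ A) :
    ((singularComplex X A).d 1 0).hom (singularChain c) =
      chainEquiv (TopCat.toSSet.obj (TopCat.of X)) A 0 (singularBoundary X A 0 c) :=
  d_chainEquiv _ A 0 c

namespace Represents

lemma boundary_eq_zero {c : Singular1 X →₀ A} {h : SingularH1 X A} (hc : Represents c h) :
    singularBoundary X A 0 c = 0 := by
  obtain ⟨z, hz, -⟩ := hc
  refine (chainEquiv (TopCat.toSSet.obj (TopCat.of X)) A 0).injective ?_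
  rw [← d_singularChain, ← hz, map_zero]
  exact congr($((singularComplex X A).iCycles_d 1 0).hom z)

lemma exists_of_boundary_eq_zero (c : Singular1 X →₀ A) (hc : singularBoundary X A 0 c = 0) :
    ∃ h : SingularH1 X A, Represents c h := by
  obtain ⟨z, hz⟩ := exists_iCycles_eq (singularComplex X A) (singularChain c)
    (by rw [d_singularChain, hc, map_zero]; rfl)
  exact ⟨_, z, hz, rfl⟩

lemma exists_chain (h : SingularH1 X A) : ∃ c : Singular1 X →₀ A, Represents c h := by
  obtain ⟨z, hz⟩ := homologyπ_surjective (singularComplex X A) h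
  obtain ⟨c, hc⟩ := (chainEquiv (TopCat.toSSet.obj (TopCat.of X)) A 1).surjective
    (((singularComplex X A).iCycles 1).hom z)
  exact ⟨c, z, hc.symm, hz⟩

lemma add {c c' : Singular1 X →₀ A} {h h' : SingularH1 X A} (hc : Represents c h)
    (hc' : Represents c' h') : Represents (c + c') (h + h') := by
  obtain ⟨z, hz, rfl⟩ := hc
  obtain ⟨z', hz', rfl⟩ := hc'
  refine ⟨z + z', ?_, map_add _ _ _⟩
  simp only [singularChain_eq] at *
  rw [map_add, map_add, hz, hz']
  rfl

lemma neg {c : Singular1 X →₀ A} {h : SingularH1 X A} (hc : Represents c h) :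
    Represents (-c) (-h) := by
  obtain ⟨z, hz, rfl⟩ := hc
  refine ⟨-z, ?_, map_neg _ _⟩
  simp only [singularChain_eq] at *
  rw [map_neg, map_neg, hz]
  rfl

lemma eq_zero_iff {c : Singular1 X →₀ A} {h : SingularH1 X A} (hc : Represents c h) :
    h = 0 ↔ c ∈ (singularBoundary X A 1).range := by
  obtain ⟨z, hz, rfl⟩ := hc
  refine (homologyπ_eq_zero_iff _ z).trans ?_
  rw [hz]
  constructor
  · rintro ⟨y, hy⟩
    obtain ⟨b, rfl⟩ := (chainEquiv (TopCat.toSSet.obj (TopCat.of X)) A 2).surjective y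
    exact ⟨b, (chainEquiv (TopCat.toSSet.obj (TopCat.of X)) A 1).injective
      ((d_chainEquiv _ A 1 b).symm.trans hy)⟩
  · rintro ⟨b, rfl⟩
    exact ⟨chainEquiv _ A 2 b, d_chainEquiv _ A 1 b⟩

lemma map (f : C(X, Y)) {c : Singular1 X →₀ A} {h : SingularH1 X A} (hc : Represents c h) :
    Represents (c.mapDomain fun σ => (TopCat.toSSet.map (TopCat.ofHom f)).app _ σ)
      ((singularH1Map A f).hom h) := by
  obtain ⟨z, hz, rfl⟩ := hc
  let F : singularComplex X A ⟶ singularComplex Y A :=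
    ((AlgebraicTopology.singularChainComplexFunctor AddCommGrpCat.{u}).obj
      (AddCommGrpCat.of A)).map (TopCat.ofHom f)
  refine ⟨(HomologicalComplex.cyclesMap F 1).hom z, ?_, ?_⟩
  · have h1 := congr($(HomologicalComplex.cyclesMap_i F 1).hom z)
    refine h1.trans ?_
    change (F.f 1).hom (((singularComplex X A).iCycles 1).hom z) = _
    rw [hz]
    suffices h2 : (F.f 1).hom.comp (chainEquiv (TopCat.toSSet.obj (TopCat.of X)) A 1).toAddMonoidHom
        = (chainEquiv (TopCat.toSSet.obj (TopCat.of Y)) A 1).toAddMonoidHom.comp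
          (Finsupp.mapDomain.addMonoidHom fun σ => (TopCat.toSSet.map (TopCat.ofHom f)).app _ σ)
      from congr($h2 c)
    refine Finsupp.addHom_ext fun s a => ?_
    have h3 := congr($(SSet.ι_chainComplexMap_f _ _ (TopCat.toSSet.map (TopCat.ofHom f))
      (AddCommGrpCat.of A) s).hom a)
    change (F.f 1).hom (finsuppToChain _ A 1 (Finsupp.single s a)) =
      finsuppToChain _ A 1 (Finsupp.mapDomain _ (Finsupp.single s a))
    rw [Finsupp.mapDomain_single, finsuppToChain_single, finsuppToChain_single]
    exact h3
  · exact (congr($(HomologicalComplex.homologyπ_naturality F 1).hom z)).symm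

end Represents

end Represents

/-! ### Singular chains modulo boundaries and the universal path cocycle -/

section SingularCocycle

open scoped Simplicial

variable {X : Type u} [TopologicalSpace X]

namespace Singular1

@[simp]
lemma ofPath_path (σ : Singular1 X) : ofPath σ.path = σ := by
  apply (TopCat.toSSetObjEquiv (TopCat.of X) _).injective
  ext b
  simp [ofPath, path]

lemma path_ofPath {x y : X} (γ : Path x y) (s : unitInterval) : (ofPath γ).path s = γ s := by
  change γ (stdSimplexHomeomorphUnitInterval (stdSimplexHomeomorphUnitInterval.symm s)) = γ s
  simp

lemma δ_one_ofPath {x y : X} (γ : Path x y) :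
    (TopCat.toSSet.obj (TopCat.of X)).δ 1 (ofPath γ) = TopCat.toSSetObj₀Equiv.symm x := by
  apply TopCat.toSSetObj₀Equiv.injective
  rw [Equiv.apply_symm_apply, TopCat.toSSetObj₀Equiv_apply]
  change γ (stdSimplexHomeomorphUnitInterval (stdSimplex.map (Fin.succAbove (1 : Fin 2))
    (default : stdSimplex ℝ (Fin 1)))) = x
  rw [Subsingleton.elim (default : stdSimplex ℝ (Fin 1)) (stdSimplex.vertex 0),
    stdSimplex.map_vertex]
  exact γ.source

lemma δ_zero_ofPath {x y : X} (γ : Path x y) :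
    (TopCat.toSSet.obj (TopCat.of X)).δ 0 (ofPath γ) = TopCat.toSSetObj₀Equiv.symm y := by
  apply TopCat.toSSetObj₀Equiv.injective
  rw [Equiv.apply_symm_apply, TopCat.toSSetObj₀Equiv_apply]
  change γ (stdSimplexHomeomorphUnitInterval (stdSimplex.map (Fin.succAbove (0 : Fin 2))
    (default : stdSimplex ℝ (Fin 1)))) = y
  rw [Subsingleton.elim (default : stdSimplex ℝ (Fin 1)) (stdSimplex.vertex 0),
    stdSimplex.map_vertex]
  exact γ.target

end Singular1

/-- The `i`-th edge of the standard triangle as a path. -/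
noncomputable def triangleEdge (i : Fin 3) :
    Path (stdSimplex.vertex (S := ℝ) (i.succAbove 0)) (stdSimplex.vertex (i.succAbove 1)) where
  toFun s := stdSimplex.map i.succAbove (stdSimplexHomeomorphUnitInterval.symm s)
  continuous_toFun := (stdSimplex.continuous_map _).comp
    stdSimplexHomeomorphUnitInterval.symm.continuous
  source' := by
    rw [← stdSimplex.map_vertex]
    congr 1
    rw [Homeomorph.symm_apply_eq]
    rfl
  target' := by
    rw [← stdSimplex.map_vertex]
    congr 1
    rw [Homeomorph.symm_apply_eq]
    rfl

lemma triangleEdge_apply (i : Fin 3) (s : unitInterval) (j : Fin 3) :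
    triangleEdge i s j = ∑ k : Fin 2, if i.succAbove k = j then ![1 - (s : ℝ), s] k else 0 := by
  change FunOnFinite.linearMap ℝ ℝ i.succAbove _ j = _
  rw [FunOnFinite.linearMap_apply_apply, Finset.sum_filter]
  refine Finset.sum_congr rfl fun k _ => ?_
  fin_cases k <;> rfl

lemma stdSimplex_fin_three_sum (b : stdSimplex ℝ (Fin 3)) : b 0 + b 1 + b 2 = 1 := by
  rw [← Fin.sum_univ_three]
  exact b.2.2

/-- The last barycentric coordinate. -/
noncomputable def lastCoord : C(stdSimplex ℝ (Fin 3), unitInterval) where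
  toFun b := ⟨b 2, b.2.1 2, by
    have := stdSimplex_fin_three_sum b
    have h0 : 0 ≤ b 0 := b.2.1 0
    have h1 : 0 ≤ b 1 := b.2.1 1
    linarith⟩
  continuous_toFun := ((continuous_apply 2).comp continuous_subtype_val).subtype_mk _

/-- The sum of the last two barycentric coordinates. -/
noncomputable def lastCoordSum : C(stdSimplex ℝ (Fin 3), unitInterval) where
  toFun b := ⟨b 1 + b 2, add_nonneg (b.2.1 1) (b.2.1 2), by
    have := stdSimplex_fin_three_sum b
    have h0 : 0 ≤ b 0 := b.2.1 0
    linarith⟩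
  continuous_toFun := (((continuous_apply 1).comp continuous_subtype_val).add
    ((continuous_apply 2).comp continuous_subtype_val)).subtype_mk _

/-- The affine function with values `0`, `1 / 2`, `1` at the vertices. -/
noncomputable def midCoord : C(stdSimplex ℝ (Fin 3), unitInterval) where
  toFun b := ⟨((lastCoord b : ℝ) + lastCoordSum b) / 2,
    by linarith [(lastCoord b).2.1, (lastCoordSum b).2.1],
    by linarith [(lastCoord b).2.2, (lastCoordSum b).2.2]⟩
  continuous_toFun := Continuous.subtype_mk (((continuous_subtype_val.comp lastCoord.continuous).add
    (continuous_subtype_val.comp lastCoordSum.continuous)).div_const 2) _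

lemma lastCoord_triangleEdge (i : Fin 3) (s : unitInterval) :
    lastCoord (triangleEdge i s) = ![s, s, 0] i := by
  apply Subtype.ext
  change triangleEdge i s 2 = _
  rw [triangleEdge_apply]
  fin_cases i <;> simp [Fin.sum_univ_two, Fin.succAbove]

lemma lastCoordSum_triangleEdge (i : Fin 3) (s : unitInterval) :
    lastCoordSum (triangleEdge i s) = ![1, s, s] i := by
  apply Subtype.ext
  change triangleEdge i s 1 + triangleEdge i s 2 = _
  rw [triangleEdge_apply, triangleEdge_apply]
  fin_cases i <;> simp [Fin.sum_univ_two, Fin.succAbove]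

lemma midCoord_triangleEdge (i : Fin 3) (s : unitInterval) :
    (midCoord (triangleEdge i s) : ℝ) = ![((s : ℝ) + 1) / 2, s, s / 2] i := by
  change ((lastCoord (triangleEdge i s) : ℝ) + lastCoordSum (triangleEdge i s)) / 2 = _
  rw [lastCoord_triangleEdge, lastCoordSum_triangleEdge]
  fin_cases i <;> simp

/-- The `2`-simplex of a continuous map on the standard triangle. -/
noncomputable def triangleSimplex (τ : C(stdSimplex ℝ (Fin 3), X)) :
    (TopCat.toSSet.obj (TopCat.of X)) _⦋2⦌ :=
  (TopCat.toSSetObjEquiv (TopCat.of X) (.op ⦋2⦌)).symm τ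

lemma δ_triangleSimplex (τ : C(stdSimplex ℝ (Fin 3), X)) (i : Fin 3) :
    (TopCat.toSSet.obj (TopCat.of X)).δ i (triangleSimplex τ) =
      Singular1.ofPath ((triangleEdge i).map τ.continuous) := by
  apply (TopCat.toSSetObjEquiv (TopCat.of X) _).injective
  ext b
  change τ (stdSimplex.map i.succAbove b) = τ (stdSimplex.map i.succAbove
    (stdSimplexHomeomorphUnitInterval.symm (stdSimplexHomeomorphUnitInterval b)))
  simp

lemma exists_triangleSimplex_eq (σ : (TopCat.toSSet.obj (TopCat.of X)) _⦋2⦌) :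
    ∃ τ, triangleSimplex τ = σ :=
  (TopCat.toSSetObjEquiv (TopCat.of X) (.op ⦋2⦌)).symm.surjective σ

variable {A : Type u} [AddCommGroup A]

/-- Singular `1`-chains modulo boundaries. -/
def ChainsModBoundaries (X : Type u) [TopologicalSpace X] (A : Type u) [AddCommGroup A] :
    Type u :=
  (Singular1 X →₀ A) ⧸ (singularBoundary X A 1).range

noncomputable instance (X : Type u) [TopologicalSpace X] (A : Type u) [AddCommGroup A] :
    AddCommGroup (ChainsModBoundaries X A) :=
  inferInstanceAs (AddCommGroup ((Singular1 X →₀ A) ⧸ (singularBoundary X A 1).range))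

/-- The class of a singular chain modulo boundaries. -/
noncomputable def chainClass (X : Type u) [TopologicalSpace X] (A : Type u) [AddCommGroup A] :
    (Singular1 X →₀ A) →+ ChainsModBoundaries X A :=
  QuotientAddGroup.mk' _

lemma chainClass_eq_zero_iff (c : Singular1 X →₀ A) :
    chainClass X A c = 0 ↔ c ∈ (singularBoundary X A 1).range :=
  QuotientAddGroup.eq_zero_iff c

lemma boundary_single_ofPath {x y : X} (γ : Path x y) (a : A) :
    singularBoundary X A 0 (Finsupp.single (Singular1.ofPath γ) a) =
      Finsupp.single (TopCat.toSSetObj₀Equiv.symm y) a -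
        Finsupp.single (TopCat.toSSetObj₀Equiv.symm x) a := by
  rw [finsuppBoundary_single]
  change ∑ k : Fin 2, _ = _
  rw [Fin.sum_univ_two, Singular1.δ_one_ofPath, Singular1.δ_zero_ofPath]
  simp [sub_eq_add_neg]

lemma boundary_single_triangleSimplex (τ : C(stdSimplex ℝ (Fin 3), X)) (a : A) :
    singularBoundary X A 1 (Finsupp.single (triangleSimplex τ) a) =
      Finsupp.single (Singular1.ofPath ((triangleEdge 0).map τ.continuous)) a -
      Finsupp.single (Singular1.ofPath ((triangleEdge 1).map τ.continuous)) a +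
      Finsupp.single (Singular1.ofPath ((triangleEdge 2).map τ.continuous)) a := by
  rw [finsuppBoundary_single]
  change ∑ k : Fin 3, _ = _
  rw [Fin.sum_univ_three, δ_triangleSimplex, δ_triangleSimplex, δ_triangleSimplex]
  simp [sub_eq_add_neg]

/-- The class of a path with coefficient modulo boundaries. -/
noncomputable def pathClass {x y : X} (γ : Path x y) : A →+ ChainsModBoundaries X A :=
  (chainClass X A).comp (Finsupp.singleAddHom (Singular1.ofPath γ))

lemma pathClass_congr {x y x' y' : X} (γ : Path x y) (γ' : Path x' y') (h : ∀ s, γ s = γ' s) :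
    (pathClass γ : A →+ _) = pathClass γ' := by
  obtain rfl : x = x' := by simpa using h 0
  obtain rfl : y = y' := by simpa using h 1
  rw [show γ = γ' from Path.ext (funext h)]

/-- The boundary of the 2-simplex τ is β - γ + α. The edges are compared pointwise because their
endpoints match those of τ only propositionally. Every later relation between path classes comes
from a suitable τ. -/
lemma pathClass_triangle (τ : C(stdSimplex ℝ (Fin 3), X)) {x y z : X} (α : Path x y) (β : Path y z)
    (γ : Path x z) (hα : ∀ s, α s = τ (triangleEdge 2 s)) (hβ : ∀ s, β s = τ (triangleEdge 0 s))
    (hγ : ∀ s, γ s = τ (triangleEdge 1 s)) :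
    (pathClass γ : A →+ _) = pathClass α + pathClass β := by
  rw [pathClass_congr α ((triangleEdge 2).map τ.continuous) hα,
    pathClass_congr β ((triangleEdge 0).map τ.continuous) hβ,
    pathClass_congr γ ((triangleEdge 1).map τ.continuous) hγ]
  ext a
  rw [← sub_eq_zero, ← neg_eq_zero]
  change -(chainClass X A _ - (chainClass X A _ + chainClass X A _)) = 0
  rw [← map_add, ← map_sub, ← map_neg, chainClass_eq_zero_iff]
  refine ⟨Finsupp.single (triangleSimplex τ) a, ?_⟩
  rw [boundary_single_triangleSimplex]
  simp only [Finsupp.singleAddHom_apply]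
  abel

/-- The constant 2-simplex gives c = c + c. -/
lemma pathClass_refl (x : X) : (pathClass (Path.refl x) : A →+ _) = 0 := by
  exact left_eq_add.1 <| pathClass_triangle (A := A) (.const _ x) (Path.refl x) (Path.refl x)
    (Path.refl x)
    (fun _ => rfl) (fun _ => rfl) (fun _ => rfl)

/-- Collapse the triangle to an interval by the affine map with values 0, 1/2, 1 at the vertices and
follow with `γ.trans δ`: the three edges become γ, δ and the concatenation. -/
lemma pathClass_trans {x y z : X} (γ : Path x y) (δ : Path y z) :
    (pathClass (γ.trans δ) : A →+ _) = pathClass γ + pathClass δ := by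
  refine pathClass_triangle ((γ.trans δ).toContinuousMap.comp midCoord) _ _ _ ?_ ?_ ?_ <;> intro s
  · change γ s = (γ.trans δ) (midCoord (triangleEdge 2 s))
    have h : (midCoord (triangleEdge 2 s) : ℝ) = s / 2 := midCoord_triangleEdge 2 s
    generalize midCoord (triangleEdge 2 s) = m at h
    rw [Path.trans_apply, dif_pos (by rw [h]; linarith [s.2.2])]
    congr 1
    ext
    simp only [h]
    ring
  · change δ s = (γ.trans δ) (midCoord (triangleEdge 0 s))
    have h : (midCoord (triangleEdge 0 s) : ℝ) = (s + 1) / 2 := midCoord_triangleEdge 0 s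
    generalize midCoord (triangleEdge 0 s) = m at h
    rw [Path.trans_apply]
    split_ifs with h1
    -- At s = 0 the midpoint 1/2 falls into the branch of γ, where both formulas give the common
    -- point y.
    · have hs : s = 0 := Subtype.ext (le_antisymm (by rw [h] at h1; simp; linarith) s.2.1)
      subst hs
      simp only [h]
      simp
    · congr 1
      ext
      simp only [h]
      ring
  · change (γ.trans δ) s = (γ.trans δ) (midCoord (triangleEdge 1 s))
    congr 1
    ext
    exact (midCoord_triangleEdge 1 s).symm

/-- Cut the square of the homotopy along its diagonal D. One triangle gives D = γ + (constant at y),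
the other D = (constant at x) + δ, and constant paths have class zero. -/
lemma pathClass_homotopic {x y : X} {γ δ : Path x y} (h : γ.Homotopic δ) :
    (pathClass γ : A →+ _) = pathClass δ := by
  obtain ⟨H⟩ := h
  let D : Path x y :=
    { toFun := fun s => H (s, s)
      continuous_toFun := by fun_prop
      source' := by simp
      target' := by simp }
  have h1 := pathClass_triangle (A := A) (H.toContinuousMap.comp (lastCoord.prodMk lastCoordSum))
    γ (Path.refl y) D
    (fun s => by
      change _ = H (lastCoord (triangleEdge 2 s), lastCoordSum (triangleEdge 2 s))
      rw [lastCoord_triangleEdge, lastCoordSum_triangleEdge]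
      simp)
    (fun s => by
      change _ = H (lastCoord (triangleEdge 0 s), lastCoordSum (triangleEdge 0 s))
      rw [lastCoord_triangleEdge, lastCoordSum_triangleEdge]
      simp)
    (fun s => by
      change H (s, s) = H (lastCoord (triangleEdge 1 s), lastCoordSum (triangleEdge 1 s))
      rw [lastCoord_triangleEdge, lastCoordSum_triangleEdge]
      simp)
  have h2 := pathClass_triangle (A := A) (H.toContinuousMap.comp (lastCoordSum.prodMk lastCoord))
    (Path.refl x) δ D
    (fun s => by
      change _ = H (lastCoordSum (triangleEdge 2 s), lastCoord (triangleEdge 2 s))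
      rw [lastCoord_triangleEdge, lastCoordSum_triangleEdge]
      simp)
    (fun s => by
      change _ = H (lastCoordSum (triangleEdge 0 s), lastCoord (triangleEdge 0 s))
      rw [lastCoord_triangleEdge, lastCoordSum_triangleEdge]
      simp)
    (fun s => by
      change H (s, s) = H (lastCoordSum (triangleEdge 1 s), lastCoord (triangleEdge 1 s))
      rw [lastCoord_triangleEdge, lastCoordSum_triangleEdge]
      simp)
  rwa [h1, pathClass_refl, pathClass_refl, add_zero, zero_add] at h2

/-- The universal path cocycle. -/
noncomputable def universalCocycle (X : Type u) [TopologicalSpace X] (A : Type u)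
    [AddCommGroup A] : PathCocycle X (A →+ ChainsModBoundaries X A) where
  val q := Quotient.lift (fun γ => pathClass γ) (fun _ _ h => pathClass_homotopic h) q
  val_trans := by
    rintro x y z ⟨γ⟩ ⟨δ⟩
    exact pathClass_trans γ δ

lemma universalCocycle_mk {x y : X} (γ : Path x y) (a : A) :
    (universalCocycle X A).val (.mk γ) a =
      chainClass X A (Finsupp.single (Singular1.ofPath γ) a) :=
  rfl

/-- The homomorphism induced by a path cocycle. -/
noncomputable def PathCocycle.lift {M : Type*} [AddCommGroup M] (h : PathCocycle X (A →+ M)) :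
    ChainsModBoundaries X A →+ M :=
  QuotientAddGroup.lift _ (Finsupp.liftAddHom fun σ => h.val (.mk σ.path)) (by
    rintro _ ⟨b, rfl⟩
    refine DFunLike.congr_fun (?_ : (Finsupp.liftAddHom fun σ : Singular1 X =>
      h.val (.mk σ.path)).comp (singularBoundary X A 1) = 0) b
    refine Finsupp.addHom_ext fun σ a => ?_
    obtain ⟨τ, rfl⟩ := exists_triangleSimplex_eq σ
    have hval : ∀ i : Fin 3, h.val (.mk (Singular1.ofPath ((triangleEdge i).map τ.continuous)).path)
        = h.val (.mk ((triangleEdge i).map τ.continuous)) := fun i =>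
      pathFunction_congr (fun q => h.val q) _ _ (Singular1.path_ofPath _)
    -- In the simply connected standard triangle, edge 1 is homotopic to edge 2 followed by edge 0.
    -- Pushing this forward along τ makes the value on the boundary of τ vanish.
    have hadd : h.val (.mk ((triangleEdge 1).map τ.continuous)) =
        h.val (.mk ((triangleEdge 2).map τ.continuous)) +
          h.val (.mk ((triangleEdge 0).map τ.continuous)) := by
      have := (convex_stdSimplex ℝ (Fin 3)).contractibleSpace ⟨_, single_mem_stdSimplex ℝ 0⟩
      have e : Path.Homotopic (triangleEdge 1) ((triangleEdge 2).trans (triangleEdge 0)) :=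
        SimplyConnectedSpace.paths_homotopic _ _
      have e' := Path.Homotopic.Quotient.eq.2 (e.map τ)
      exact (congrArg h.val e').trans
        ((congrArg (fun q => h.val (.mk q)) (Path.map_trans _ _ _)).trans
        (h.val_trans (.mk ((triangleEdge 2).map τ.continuous))
          (.mk ((triangleEdge 0).map τ.continuous))))
    rw [AddMonoidHom.comp_apply, boundary_single_triangleSimplex]
    simp only [map_add, map_sub, Finsupp.liftAddHom_apply_single, hval, hadd,
      AddMonoidHom.add_apply]
    simp)

lemma PathCocycle.lift_mk {M : Type*} [AddCommGroup M] (h : PathCocycle X (A →+ M))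
    (c : Singular1 X →₀ A) :
    h.lift (chainClass X A c) = c.sum fun σ a => h.val (.mk σ.path) a :=
  rfl

end SingularCocycle

/-! ### Evaluating path cocycles on homology classes -/

section Evaluation

open scoped Simplicial

variable {X Y : Type u} [TopologicalSpace X] [TopologicalSpace Y] {A : Type u} [AddCommGroup A]
  {M : Type*} [AddCommGroup M]

lemma Represents.chainClass_eq {c c' : Singular1 X →₀ A} {h : SingularH1 X A}
    (hc : Represents c h) (hc' : Represents c' h) : chainClass X A c = chainClass X A c' := by
  rw [← sub_eq_zero, ← map_sub, chainClass_eq_zero_iff, sub_eq_add_neg]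
  exact (hc.add hc'.neg).eq_zero_iff.1 (add_neg_cancel h)

/-- A homology class as a class of chains modulo boundaries. -/
noncomputable def homologyToChains (X : Type u) [TopologicalSpace X] (A : Type u)
    [AddCommGroup A] : SingularH1 X A →+ ChainsModBoundaries X A :=
  AddMonoidHom.mk' (fun h => chainClass X A (Represents.exists_chain h).choose) fun h h' => by
    rw [← map_add]
    exact (Represents.exists_chain (h + h')).choose_spec.chainClass_eq
      ((Represents.exists_chain h).choose_spec.add (Represents.exists_chain h').choose_spec)

lemma Represents.homologyToChains_eq {c : Singular1 X →₀ A} {h : SingularH1 X A}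
    (hc : Represents c h) : homologyToChains X A h = chainClass X A c :=
  (Represents.exists_chain h).choose_spec.chainClass_eq hc

/-- This lets identities in homology be checked among chains modulo boundaries, where cocycles can
be evaluated. -/
lemma homologyToChains_injective : Function.Injective (homologyToChains X A) := by
  refine (injective_iff_map_eq_zero _).2 fun h hh => ?_
  obtain ⟨c, hc⟩ := Represents.exists_chain h
  rwa [hc.homologyToChains_eq, chainClass_eq_zero_iff, ← hc.eq_zero_iff] at hh

namespace PathCocycle

/-- The pullback of a path cocycle along a continuous map. -/
def comap (h : PathCocycle Y M) (f : C(X, Y)) : PathCocycle X M where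
  val γ := h.val (γ.map f)
  val_trans := by
    rintro x y z ⟨γ⟩ ⟨δ⟩
    exact (congrArg (fun q => h.val (.mk q)) (Path.map_trans γ δ f.continuous)).trans
      (h.val_trans (.mk (γ.map f.continuous)) (.mk (δ.map f.continuous)))

lemma comap_mk (h : PathCocycle Y M) (f : C(X, Y)) {x y : X} (γ : Path x y) :
    (h.comap f).val (.mk γ) = h.val (.mk (γ.map f.continuous)) :=
  rfl

lemma lift_single_ofPath (h : PathCocycle X (A →+ M)) {x y : X} (γ : Path x y) (a : A) :
    h.lift (chainClass X A (Finsupp.single (Singular1.ofPath γ) a)) = h.val (.mk γ) a := by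
  rw [lift_mk, Finsupp.sum_single_index
    (h := fun (σ : Singular1 X) a => h.val (.mk σ.path) a) (map_zero _),
    pathFunction_congr (fun q => h.val q) _ γ (Singular1.path_ofPath γ)]

lemma lift_singularH1Map (h : PathCocycle Y (A →+ M)) (f : C(X, Y)) (x : SingularH1 X A) :
    h.lift (homologyToChains Y A ((singularH1Map A f).hom x)) =
      (h.comap f).lift (homologyToChains X A x) := by
  obtain ⟨c, hc⟩ := Represents.exists_chain x
  rw [hc.homologyToChains_eq, (hc.map f).homologyToChains_eq]
  refine DFunLike.congr_fun (?_ : (h.lift.comp (chainClass Y A)).comp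
    (Finsupp.mapDomain.addMonoidHom _) = (h.comap f).lift.comp (chainClass X A)) c
  refine Finsupp.addHom_ext fun σ a => ?_
  have e : (TopCat.toSSet.map (TopCat.ofHom f)).app _ σ =
      Singular1.ofPath (σ.path.map f.continuous) := by
    apply (TopCat.toSSetObjEquiv (TopCat.of Y) _).injective
    ext b
    change _ = f (TopCat.toSSetObjEquiv _ _ σ (stdSimplexHomeomorphUnitInterval.symm
      (stdSimplexHomeomorphUnitInterval b)))
    rw [Homeomorph.symm_apply_apply]
    rfl
  simp only [AddMonoidHom.comp_apply, Finsupp.mapDomain.addMonoidHom_apply,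
    Finsupp.mapDomain_single]
  rw [e, lift_single_ofPath, ← comap_mk, ← lift_single_ofPath, Singular1.ofPath_path]

/-- Two path cocycles that differ by a potential agree on cycles. -/
lemma lift_eq_of_potential (h h' : PathCocycle X (A →+ M)) (κ : X → A →+ M)
    (e : ∀ {x y : X} (γ : Path x y), h.val (.mk γ) = h'.val (.mk γ) + (κ x - κ y))
    (c : Singular1 X →₀ A) (hc : singularBoundary X A 0 c = 0) :
    h.lift (chainClass X A c) = h'.lift (chainClass X A c) := by
  -- The lifts differ by minus κ evaluated on the boundary of the chain, which is zero for a cycle.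
  have key : h.lift.comp (chainClass X A) = h'.lift.comp (chainClass X A) -
      (Finsupp.liftAddHom fun s => κ (TopCat.toSSetObj₀Equiv s)).comp (singularBoundary X A 0) := by
    refine Finsupp.addHom_ext fun σ a => ?_
    rw [← Singular1.ofPath_path σ, AddMonoidHom.sub_apply, AddMonoidHom.comp_apply,
      AddMonoidHom.comp_apply, AddMonoidHom.comp_apply, boundary_single_ofPath,
      lift_single_ofPath, lift_single_ofPath, e, map_sub, Finsupp.liftAddHom_apply_single,
      Finsupp.liftAddHom_apply_single, Equiv.apply_symm_apply, Equiv.apply_symm_apply,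
      AddMonoidHom.add_apply, AddMonoidHom.sub_apply]
    abel
  have := DFunLike.congr_fun key c
  simpa [hc] using this

end PathCocycle

end Evaluation

/-! ### Simplicial cycles in spaces -/

section SimplicialCycles

variable {ι : Type v} [LinearOrder ι] {K : PreAbstractSimplicialComplex ι} {A : Type u}
  [AddCommGroup A] {M : Type*} [AddCommGroup M]

/-- A vertex as a `0`-simplex. -/
def Simplex.toVertex (s : Simplex K 0) : Vertex K :=
  ⟨s.1 0, s.mem_of_subset (by simp) (by simp)⟩

lemma Simplex.toVertex_face_zero (e : Simplex K 1) : (e.face 0).toVertex = e.tgt :=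
  rfl

lemma Simplex.toVertex_face_one (e : Simplex K 1) : (e.face 1).toVertex = e.src :=
  rfl

lemma simplicialBoundary_zero_single (e : Simplex K 1) (a : A) :
    simplicialBoundary K A 0 (Finsupp.single e a) =
      Finsupp.single (e.face 0) a - Finsupp.single (e.face 1) a := by
  simp only [simplicialBoundary, AddMonoidHom.finsetSum_apply, AddMonoidHom.smul_apply,
    Finsupp.mapDomain.addMonoidHom_apply, Finsupp.mapDomain_single]
  change ∑ k : Fin 2, _ = _
  rw [Fin.sum_univ_two]
  simp [sub_eq_add_neg]

lemma simplicialBoundary_one_single (s : Simplex K 2) (a : A) :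
    simplicialBoundary K A 1 (Finsupp.single s a) = Finsupp.single (s.face 0) a -
      Finsupp.single (s.face 1) a + Finsupp.single (s.face 2) a := by
  simp only [simplicialBoundary, AddMonoidHom.finsetSum_apply, AddMonoidHom.smul_apply,
    Finsupp.mapDomain.addMonoidHom_apply, Finsupp.mapDomain_single]
  change ∑ k : Fin 3, _ = _
  rw [Fin.sum_univ_three]
  simp [sub_eq_add_neg]

/-- The sum over a simplicial chain of a function of its edges that is a sum of a coboundary and
another function. -/
lemma sum_edges_eq_of_potential (h t : Simplex K 1 → A →+ M) (κ : Vertex K → A →+ M)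
    (e : ∀ s, h s = t s + (κ s.src - κ s.tgt)) (c : simplicialCycles K A) :
    (c.1.sum fun s a => h s a) = c.1.sum fun s a => t s a := by
  have key : Finsupp.liftAddHom h = Finsupp.liftAddHom t -
      (Finsupp.liftAddHom fun s => κ s.toVertex).comp (simplicialBoundary K A 0) := by
    refine Finsupp.addHom_ext fun s a => ?_
    rw [AddMonoidHom.sub_apply, AddMonoidHom.comp_apply, simplicialBoundary_zero_single,
      map_sub, Finsupp.liftAddHom_apply_single, Finsupp.liftAddHom_apply_single,
      Finsupp.liftAddHom_apply_single, Finsupp.liftAddHom_apply_single, e,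
      Simplex.toVertex_face_zero, Simplex.toVertex_face_one, AddMonoidHom.add_apply,
      AddMonoidHom.sub_apply]
    abel
  have := DFunLike.congr_fun key c.1
  rwa [AddMonoidHom.sub_apply, AddMonoidHom.comp_apply,
    show simplicialBoundary K A 0 c.1 = 0 from c.2, map_zero, sub_zero] at this

variable {X : Type u} [TopologicalSpace X]

lemma singularBoundary_mapDomain_ofPath (r : Vertex K → X)
    (γ : ∀ e : Simplex K 1, Path (r e.src) (r e.tgt)) (c : simplicialCycles K A) :
    singularBoundary X A 0 (c.1.mapDomain fun e => Singular1.ofPath (γ e)) = 0 := by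
  have key : (singularBoundary X A 0).comp (Finsupp.mapDomain.addMonoidHom fun e =>
      Singular1.ofPath (γ e)) = (Finsupp.mapDomain.addMonoidHom fun s : Simplex K 0 =>
        TopCat.toSSetObj₀Equiv.symm (r s.toVertex)).comp (simplicialBoundary K A 0) := by
    refine Finsupp.addHom_ext fun s a => ?_
    rw [AddMonoidHom.comp_apply, AddMonoidHom.comp_apply, simplicialBoundary_zero_single,
      Finsupp.mapDomain.addMonoidHom_apply, Finsupp.mapDomain_single, boundary_single_ofPath,
      map_sub, Finsupp.mapDomain.addMonoidHom_apply, Finsupp.mapDomain.addMonoidHom_apply,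
      Finsupp.mapDomain_single, Finsupp.mapDomain_single]
    rfl
  have := DFunLike.congr_fun key c.1
  rwa [AddMonoidHom.comp_apply, AddMonoidHom.comp_apply,
    show simplicialBoundary K A 0 c.1 = 0 from c.2, map_zero] at this

/-- Evaluation of a path cocycle with local potentials on a simplicial cycle realised by paths. -/
theorem PathCocycle.lift_mapDomain_ofPath {U : ι → Set X} (hU : ∀ i, IsOpen (U i))
    (h : PathCocycle X (A →+ M)) (k : ι → X → A →+ M) (t : Simplex K 1 → A →+ M)
    (hk : ∀ (i : ι) {x y : X} (γ : Path x y), (∀ s, γ s ∈ U i) →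
      h.val (.mk γ) = k i x - k i y)
    (ht : ∀ (e : Simplex K 1), ∀ x ∈ U e.src.val, x ∈ U e.tgt.val →
      k e.tgt.val x = k e.src.val x + t e)
    (r : Vertex K → X) (hr : ∀ i, r i ∈ U i.val)
    (γ : ∀ e : Simplex K 1, Path (r e.src) (r e.tgt))
    (hγ : ∀ e s, γ e s ∈ U e.src.val ∪ U e.tgt.val) (c : simplicialCycles K A) :
    h.lift (chainClass X A (c.1.mapDomain fun e => Singular1.ofPath (γ e))) =
      c.1.sum fun e a => t e a := by
  -- The value on the path of an edge is k_src(r src) + t - k_tgt(r tgt). The terms k(r) depend only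
  -- on the vertices, so they drop out on a cycle.
  rw [← sum_edges_eq_of_potential (fun e => h.val (.mk (γ e))) t (fun v => k v.val (r v))
    (fun e => by
      rw [h.val_eq_of_mem_union (hU _) (hU _) _ _ _ (hk e.src.val) (hk e.tgt.val) (ht e) (γ e)
        (hγ e) (hr _) (hr _)]
      abel) c]
  rw [h.lift_mk, Finsupp.sum_mapDomain_index (fun _ => map_zero _) (fun _ _ _ => map_add _ _ _)]
  refine Finsupp.sum_congr fun e _ => ?_
  rw [pathFunction_congr (fun q => h.val q) _ (γ e) (Singular1.path_ofPath (γ e))]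

end SimplicialCycles

/-! ### Composition of cocycles with homomorphisms -/

section PathCocycleMap

variable {X : Type u} [TopologicalSpace X] {A : Type u} [AddCommGroup A]
  {M N : Type*} [AddCommGroup M] [AddCommGroup N]

namespace PathCocycle

/-- Composition of a path cocycle of homomorphisms with a homomorphism. -/
def postcomp (h : PathCocycle X (A →+ M)) (φ : M →+ N) : PathCocycle X (A →+ N) where
  val γ := φ.comp (h.val γ)
  val_trans γ δ := by
    ext
    simp [h.val_trans]

lemma lift_postcomp (h : PathCocycle X (A →+ M)) (φ : M →+ N) (x : ChainsModBoundaries X A) :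
    (h.postcomp φ).lift x = φ (h.lift x) := by
  obtain ⟨c, rfl⟩ := QuotientAddGroup.mk_surjective x
  exact (map_finsuppSum φ c _).symm

/-- This turns a comparison of some cocycle with the universal one into a statement about the chain
itself; both inverse maps are checked this way. -/
lemma lift_universalCocycle (x : ChainsModBoundaries X A) :
    (universalCocycle X A).lift x = x := by
  obtain ⟨c, rfl⟩ := QuotientAddGroup.mk_surjective x
  change (universalCocycle X A).lift (chainClass X A c) = chainClass X A c
  refine DFunLike.congr_fun (?_ : (universalCocycle X A).lift.comp (chainClass X A) = _) c
  refine Finsupp.addHom_ext fun σ a => ?_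
  rw [← Singular1.ofPath_path σ, AddMonoidHom.comp_apply, lift_single_ofPath, universalCocycle_mk]

end PathCocycle

end PathCocycleMap

/-! ### Monodromy of quotient coverings -/

section Monodromy

variable {Y : Type u} {E : Type*} [TopologicalSpace Y] [TopologicalSpace E]
  {Γ : Type w} [Group Γ] [MulAction Γ E] {p : E → Y} (hp : IsQuotientCoveringMap p Γ)

section Elt

variable (l : Y → E) (hl : ∀ y, p (l y) = y)

/-- Uniqueness of path lifting: any lift with the right endpoints computes the monodromy. The
endpoints are free variables with equations, so that no path has to be cast. -/
lemma monodromyElt_eq {x y : Y} (γ : Path x y) (g : Γ) {e e' : E} (ω : Path e e')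
    (he : e = l x) (he' : e' = g • l y) (h : ∀ s, p (ω s) = γ s) :
    monodromyElt hp l hl (.mk γ) = g := by
  subst he
  refine (hp.fiberEquivGroup_eq_iff _ _ _).2 (Eq.trans ?_ he')
  have := (hp.isCoveringMap.eq_liftPath_iff' (γ := γ) (e := l x)
    (γ.source.trans (hl x).symm) (Γ := ω.toContinuousMap)).2 ⟨funext h, ω.source⟩
  exact congr($this 1).symm.trans ω.target

lemma exists_lift {x y : Y} (γ : Path x y) :
    ∃ ω : Path (l x) (monodromyElt hp l hl (.mk γ) • l y), ∀ s, p (ω s) = γ s := by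
  have h0 : γ 0 = p (l x) := γ.source.trans (hl x).symm
  refine ⟨⟨hp.isCoveringMap.liftPath γ (l x) h0, hp.isCoveringMap.liftPath_zero _ _ _, ?_⟩,
    fun s => congr_fun (hp.isCoveringMap.liftPath_lifts γ (l x) h0) s⟩
  exact (hp.fiberEquivGroup_smul_self (⟨l y, hl y⟩ : p ⁻¹' {y})
    (e' := hp.isCoveringMap.monodromy (.mk γ) ⟨l x, hl x⟩)).symm

/-- Translate the lift of δ by the monodromy of γ, so that it starts where the lift of γ ends, and
concatenate. -/
lemma monodromyElt_trans {x y z : Y} (γ : Path x y) (δ : Path y z) :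
    monodromyElt hp l hl (.mk (γ.trans δ)) =
      monodromyElt hp l hl (.mk γ) * monodromyElt hp l hl (.mk δ) := by
  obtain ⟨ω, hω⟩ := exists_lift hp l hl γ
  obtain ⟨ω', hω'⟩ := exists_lift hp l hl δ
  refine monodromyElt_eq hp l hl _ _ (ω.trans (ω'.map (hp.continuous_const_smul _))) rfl
    (smul_smul _ _ _) fun s => ?_
  rw [Path.trans_apply, Path.trans_apply]
  split_ifs
  · exact hω _
  · exact (hp.map_smul _).trans (hω' _)

-- Translating a lift by k(x) moves its start from l(x) to l'(x). After abelianisation the two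
-- factors k become a potential.
variable {l hl} in
lemma monodromyElt_change {l' : Y → E} {hl' : ∀ y, p (l' y) = y} (k : Y → Γ)
    (hk : ∀ y, k y • l y = l' y) {x y : Y} (γ : Path x y) :
    monodromyElt hp l' hl' (.mk γ) = k x * monodromyElt hp l hl (.mk γ) * (k y)⁻¹ := by
  obtain ⟨ω, hω⟩ := exists_lift hp l hl γ
  refine monodromyElt_eq hp l' hl' γ _ (ω.map (hp.continuous_const_smul (k x))) (hk x) ?_
    fun s => (hp.map_smul _).trans (hω s)
  rw [← hk y, smul_smul, smul_smul]
  simp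

end Elt

/-- The homomorphism `a ↦ ab g ⊗ a`. -/
noncomputable def abTensor (A : Type u) [AddCommGroup A] (g : Γ) :
    A →+ Additive (Abelianization Γ) ⊗[ℤ] A :=
  (TensorProduct.mk ℤ (Additive (Abelianization Γ)) A (abClass g)).toAddMonoidHom

variable {A : Type u} [AddCommGroup A]

lemma abTensor_apply (g : Γ) (a : A) : abTensor A g a = abClass g ⊗ₜ[ℤ] a :=
  rfl

lemma abTensor_mul (g h : Γ) : abTensor A (g * h) = abTensor A g + abTensor A h := by
  ext a
  simp [abTensor_apply, abClass, TensorProduct.add_tmul]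

lemma abTensor_inv (g : Γ) : abTensor A g⁻¹ = -abTensor A g := by
  ext a
  simp [abTensor_apply, abClass, TensorProduct.neg_tmul]

/-- The path cocycle `γ ↦ (a ↦ ab (μ γ) ⊗ a)`. -/
noncomputable def monodromyCocycle (A : Type u) [AddCommGroup A] (l : Y → E)
    (hl : ∀ y, p (l y) = y) : PathCocycle Y (A →+ Additive (Abelianization Γ) ⊗[ℤ] A) where
  val γ := abTensor A (monodromyElt hp l hl γ)
  val_trans := by
    rintro x y z ⟨γ⟩ ⟨δ⟩
    exact (congrArg (abTensor A) (monodromyElt_trans hp l hl γ δ)).trans (abTensor_mul _ _)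

lemma monodromyCocycle_mk (l : Y → E) (hl : ∀ y, p (l y) = y) {x y : Y} (γ : Path x y) :
    (monodromyCocycle hp A l hl).val (.mk γ) = abTensor A (monodromyElt hp l hl (.mk γ)) :=
  rfl

lemma lift_monodromyCocycle_eq {l l' : Y → E} (hl : ∀ y, p (l y) = y) (hl' : ∀ y, p (l' y) = y)
    (c : Singular1 Y →₀ A) (hc : singularBoundary Y A 0 c = 0) :
    (monodromyCocycle hp A l' hl').lift (chainClass Y A c) =
      (monodromyCocycle hp A l hl).lift (chainClass Y A c) := by
  have hk : ∀ y, ∃ k : Γ, k • l y = l' y := fun y =>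
    hp.apply_eq_iff_mem_orbit.1 ((hl' y).trans (hl y).symm)
  choose k hk using hk
  refine PathCocycle.lift_eq_of_potential _ _ (fun y => abTensor A (k y)) (fun γ => ?_) c hc
  rw [monodromyCocycle_mk, monodromyCocycle_mk, monodromyElt_change hp (hl := hl) k hk,
    abTensor_mul, abTensor_mul, abTensor_inv]
  abel

/-! ### Images in the base of paths in the universal covering -/

section Transport

variable [SimplyConnectedSpace E]

/-- The class of the image of a path between two points of the total space. -/
noncomputable def transportClass (A : Type u) [AddCommGroup A] (e e' : E) :
    A →+ ChainsModBoundaries Y A :=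
  pathClass ((PathConnectedSpace.somePath e e').map hp.continuous)

lemma transportClass_eq {e e' : E} (ω : Path e e') :
    transportClass hp A e e' = pathClass (ω.map hp.continuous) :=
  pathClass_homotopic ((SimplyConnectedSpace.paths_homotopic _ _).map ⟨p, hp.continuous⟩)

lemma transportClass_trans (e e' e'' : E) :
    transportClass hp A e e'' = transportClass hp A e e' + transportClass hp A e' e'' := by
  rw [transportClass_eq hp ((PathConnectedSpace.somePath e e').trans
    (PathConnectedSpace.somePath e' e'')), Path.map_trans, pathClass_trans]
  rfl

/-- A path and its translate by g have the same image under p. -/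
lemma transportClass_smul (g : Γ) (e e' : E) :
    transportClass hp A (g • e) (g • e') = transportClass hp A e e' := by
  rw [transportClass_eq hp ((PathConnectedSpace.somePath e e').map (hp.continuous_const_smul g))]
  exact pathClass_congr _ _ fun s => hp.map_smul g

lemma pathClass_eq_transportClass {x y : Y} (γ : Path x y) {e e' : E} (ω : Path e e')
    (h : ∀ s, p (ω s) = γ s) : pathClass γ = transportClass hp A e e' := by
  rw [transportClass_eq hp ω]
  exact pathClass_congr _ _ fun s => (h s).symm

/-- The homomorphism from the abelianised deck group sending `g` to the class of the image of a
path from `e` to `g • e`. -/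
noncomputable def loopHom (A : Type u) [AddCommGroup A] (e : E) :
    Additive (Abelianization Γ) →+ A →+ ChainsModBoundaries Y A :=
  MonoidHom.toAdditiveLeft (Abelianization.lift
    { toFun := fun g => Multiplicative.ofAdd (transportClass hp A e (g • e))
      map_one' := by
        rw [one_smul]
        exact congrArg Multiplicative.ofAdd
          (left_eq_add.1 (transportClass_trans (A := A) hp e e e))
      map_mul' := fun g h => by
        rw [transportClass_trans hp e (g • e), mul_smul, transportClass_smul]
        rfl })

/-- The homomorphism `ab g ⊗ a ↦ [γ ⊗ a]`, where `γ` lifts to a path from `e` to `g • e`. -/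
noncomputable def loopTensorHom (A : Type u) [AddCommGroup A] (e : E) :
    Additive (Abelianization Γ) ⊗[ℤ] A →+ ChainsModBoundaries Y A :=
  TensorProduct.liftAddHom (loopHom hp A e) fun r m n => by simp

lemma loopTensorHom_tmul (e : E) (b : Additive (Abelianization Γ)) (a : A) :
    loopTensorHom hp A e (b ⊗ₜ[ℤ] a) = loopHom hp A e b a := by
  rw [loopTensorHom, TensorProduct.liftAddHom_tmul]

/-- Write T for the transport class and μ for the monodromy of a path from x to y. Splitting T(e, μ
• l y) at l x and at μ • e, and using invariance under μ, gives T(e, μ • e) = T(l x, μ • l y) + T(e,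
l x) - T(e, l y). The first term on the right is the universal cocycle, the rest is a potential. -/
lemma loopTensorHom_lift_monodromyCocycle (l : Y → E) (hl : ∀ y, p (l y) = y) (e : E)
    (c : Singular1 Y →₀ A) (hc : singularBoundary Y A 0 c = 0) :
    loopTensorHom hp A e ((monodromyCocycle hp A l hl).lift (chainClass Y A c)) =
      chainClass Y A c := by
  rw [← PathCocycle.lift_postcomp]
  refine (PathCocycle.lift_eq_of_potential _ (universalCocycle Y A)
    (fun y => transportClass hp A e (l y)) (fun {x y} γ => ?_) c hc).trans
    (PathCocycle.lift_universalCocycle _)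
  obtain ⟨ω, hω⟩ := exists_lift hp l hl γ
  have h1 : (universalCocycle Y A).val (.mk γ) =
      transportClass hp A (l x) (monodromyElt hp l hl (.mk γ) • l y) :=
    pathClass_eq_transportClass hp γ ω hω
  have h2 : ((monodromyCocycle hp A l hl).postcomp (loopTensorHom hp A e)).val (.mk γ) =
      transportClass hp A e (monodromyElt hp l hl (.mk γ) • e) := by
    ext a
    exact loopTensorHom_tmul hp e (abClass (monodromyElt hp l hl (.mk γ))) a
  rw [h1, h2, ← transportClass_smul hp (monodromyElt hp l hl (.mk γ)) e (l y)]
  have h3 := transportClass_trans (A := A) hp e (l x) (monodromyElt hp l hl (.mk γ) • l y)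
  have h4 := transportClass_trans (A := A) hp e (monodromyElt hp l hl (.mk γ) • e)
    (monodromyElt hp l hl (.mk γ) • l y)
  rw [h4] at h3
  rw [eq_sub_of_add_eq h3]
  abel

end Transport

variable [SimplyConnectedSpace E]

/-- The first homology of the base of a universal covering. -/
theorem exists_homology_equiv_abelianization (hp : IsQuotientCoveringMap p Γ) (A : Type u)
    [AddCommGroup A] :
    ∃ Ψ : SingularH1 Y A ≃+ Additive (Abelianization Γ) ⊗[ℤ] A,
      ∀ (l : Y → E) (hl : ∀ y, p (l y) = y) (h : SingularH1 Y A),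
        Ψ h = (monodromyCocycle hp A l hl).lift (homologyToChains Y A h) := by
  obtain ⟨l, hl⟩ : ∃ l : Y → E, ∀ y, p (l y) = y := hp.surjective.hasRightInverse
  obtain ⟨e⟩ : Nonempty E := inferInstance
  let ψ : SingularH1 Y A →+ Additive (Abelianization Γ) ⊗[ℤ] A :=
    (monodromyCocycle hp A l hl).lift.comp (homologyToChains Y A)
  have hinj : Function.Injective ψ := by
    refine Function.Injective.of_comp (f := loopTensorHom hp A e) ?_
    convert homologyToChains_injective (X := Y) (A := A) using 1
    funext h
    obtain ⟨c, hc⟩ := Represents.exists_chain h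
    change loopTensorHom hp A e ((monodromyCocycle hp A l hl).lift (homologyToChains Y A h)) = _
    rw [hc.homologyToChains_eq]
    exact loopTensorHom_lift_monodromyCocycle hp l hl e c hc.boundary_eq_zero
  have hsurj : Function.Surjective ψ := by
    intro z
    induction z with
    | zero => exact ⟨0, map_zero _⟩
    | add z z' hz hz' =>
      obtain ⟨h, rfl⟩ := hz
      obtain ⟨h', rfl⟩ := hz'
      exact ⟨h + h', map_add _ _ _⟩
    | tmul b a =>
      obtain ⟨g, rfl⟩ : ∃ g, abClass g = b := QuotientGroup.mk_surjective b
      -- A path upstairs from l(y) to g • l(y) projects to a loop, hence to a cycle, with monodromy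
      -- g.
      let y := p e
      let ω := PathConnectedSpace.somePath (l y) (g • l y)
      let γ : Path y y := (ω.map hp.continuous).cast (hl y).symm
        ((hp.map_smul g).trans (hl y)).symm
      obtain ⟨h, hh⟩ := Represents.exists_of_boundary_eq_zero
        (Finsupp.single (Singular1.ofPath γ) a) (by rw [boundary_single_ofPath, sub_self])
      refine ⟨h, ?_⟩
      change (monodromyCocycle hp A l hl).lift (homologyToChains Y A h) = _
      rw [hh.homologyToChains_eq, PathCocycle.lift_single_ofPath, monodromyCocycle_mk,
        monodromyElt_eq hp l hl γ g ω rfl rfl (fun _ => rfl), abTensor_apply]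
  refine ⟨AddEquiv.ofBijective ψ ⟨hinj, hsurj⟩, fun l' hl' h => ?_⟩
  obtain ⟨c, hc⟩ := Represents.exists_chain h
  change (monodromyCocycle hp A l hl).lift (homologyToChains Y A h) = _
  rw [hc.homologyToChains_eq]
  exact lift_monodromyCocycle_eq hp hl' hl c hc.boundary_eq_zero

end Monodromy

/-! ### Path cocycles from transition cocycles -/

section Holonomy

variable {X : Type*} [TopologicalSpace X] {ι : Type*} {U : ι → Set X} {M : Type*} [AddCommGroup M]

/-- A constant cocycle on an open cover is the transition cocycle of local potentials of a path
cocycle. -/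
theorem exists_pathCocycle_of_transition (hU : ∀ i, IsOpen (U i)) (hc : ⋃ i, U i = Set.univ)
    (t : ι → ι → M)
    (ht : ∀ i j l x, x ∈ U i → x ∈ U j → x ∈ U l → t i j + t j l = t i l) :
    ∃ (h : PathCocycle X M) (k : ι → X → M),
      (∀ (i : ι) {x y : X} (γ : Path x y), (∀ s, γ s ∈ U i) →
        h.val (.mk γ) = k i x - k i y) ∧
      ∀ i j, ∀ x ∈ U i, x ∈ U j → k j x = k i x + t i j := by
  have hcov : ∀ x, ∃ i, x ∈ U i := fun x => Set.mem_iUnion.1 (hc ▸ Set.mem_univ x)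
  choose idx hidx using hcov
  let : TopologicalSpace M := ⊥
  have : DiscreteTopology M := ⟨rfl⟩
  have hself : ∀ i, ∀ x ∈ U i, t i i = 0 := fun i x hx => by simpa using ht i i i x hx hx hx
  -- The covering with discrete fibre M and the translations by t_ij as transition maps.
  let Z : FiberBundleCore ι X M :=
    { baseSet := U
      isOpen_baseSet := hU
      indexAt := idx
      mem_baseSet_at := hidx
      coordChange := fun i j _ v => v + t i j
      coordChange_self := fun i x hx v => by rw [hself i x hx, add_zero]
      continuousOn_coordChange := fun i j =>
        ((continuous_of_discreteTopology (f := fun v : M => v + t i j)).comp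
          continuous_snd).continuousOn
      coordChange_comp := fun i j l x hx v => by
        rw [add_assoc, ht i j l x hx.1.1 hx.1.2 hx.2] }
  have cov : IsCoveringMap Z.proj :=
    IsCoveringMap.mk _ (fun _ => M) (fun x => Z.localTriv (idx x)) hidx
  let pt (x : X) (v : M) : Z.proj ⁻¹' {x} := ⟨⟨x, v⟩, rfl⟩
  have pt_inj : ∀ x v v', pt x v = pt x v' → v = v' := fun x v v' h =>
    eq_of_heq (Bundle.TotalSpace.mk.inj (congrArg Subtype.val h)).2
  have loc : ∀ (i : ι) {x y : X} (γ : Path x y), (∀ s, γ s ∈ U i) → ∀ v,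
      cov.monodromy (.mk γ) (pt x v) = pt y (v + (t (idx x) i + t i (idx y))) := by
    intro i x y γ hγ v
    have h0 : x ∈ U i := by simpa using hγ 0
    -- The lift is constant in the i-th trivialisation. The added t (idx x) i converts v from the
    -- preferred chart at x to the i-th one.
    let ω : C(unitInterval, Z.TotalSpace) :=
      { toFun := fun s => (Z.localTriv i).toOpenPartialHomeomorph.symm (γ s, v + t (idx x) i)
        continuous_toFun :=
          (Z.localTriv i).toOpenPartialHomeomorph.continuousOn_symm.comp_continuous
            (by fun_prop) fun s => (Z.mem_localTriv_target i _).2 (hγ s) }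
    have hω := (cov.eq_liftPath_iff' (γ := γ) (e := (⟨x, v⟩ : Z.TotalSpace)) γ.source
      (Γ := ω)).2 ⟨rfl, by
        change (⟨γ 0, v + t (idx x) i + t i (idx (γ 0))⟩ : Z.TotalSpace) = ⟨x, v⟩
        rw [γ.source, add_assoc, ht _ _ _ x (hidx x) h0 (hidx x), hself _ x (hidx x), add_zero]⟩
    refine Subtype.ext ?_
    refine (congr($hω 1).symm).trans ?_
    change (⟨γ 1, v + t (idx x) i + t i (idx (γ 1))⟩ : Z.TotalSpace) = ⟨y, _⟩
    rw [γ.target, add_assoc]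
  -- Monodromy is a translation between fibres: true for small paths by `loc`, and preserved by
  -- concatenation. The amount of translation is the desired cocycle.
  have ex : ∀ {x y : X} (q : Path.Homotopic.Quotient x y), ∃ d : M, ∀ v,
      cov.monodromy q (pt x v) = pt y (v + d) := by
    rintro x y ⟨γ⟩
    refine path_induction hU (fun {x y} q => ∃ d : M, ∀ v, cov.monodromy q (pt x v) = pt y (v + d))
      (fun i x y γ hγ => ⟨_, loc i γ hγ⟩) ?_ γ fun s => ⟨_, hidx (γ s)⟩
    rintro x y z q q' ⟨d, hd⟩ ⟨d', hd'⟩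
    exact ⟨d + d', fun v => by rw [cov.monodromy_trans_apply, hd, hd', add_assoc]⟩
  have uniq : ∀ {x y : X} (q : Path.Homotopic.Quotient x y) (d : M),
      (∀ v, cov.monodromy q (pt x v) = pt y (v + d)) → (ex q).choose = d := fun q d hd =>
    add_left_cancel (pt_inj _ _ _ (((ex q).choose_spec 0).symm.trans (hd 0)))
  refine ⟨⟨fun q => (ex q).choose, fun q q' => uniq _ _ fun v => ?_⟩, fun i x => t (idx x) i,
    fun i x y γ hγ => ?_, fun i j x hi hj => (ht _ _ _ x (hidx x) hi hj).symm⟩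
  · rw [cov.monodromy_trans_apply, (ex q).choose_spec, (ex q').choose_spec, add_assoc]
  · refine (uniq _ _ (loc i γ hγ)).trans ?_
    have h1 : y ∈ U i := by simpa using hγ 1
    have := ht i (idx y) i y h1 (hidx y) h1
    rw [hself i y h1] at this
    rw [eq_neg_of_add_eq_zero_left this]
    abel

/-- Two path cocycles with the same transition cocycle differ by a potential. -/
theorem exists_potential_of_transition_eq (hU : ∀ i, IsOpen (U i)) (hc : ⋃ i, U i = Set.univ)
    (t : ι → ι → M) (h h' : PathCocycle X M) (k k' : ι → X → M)
    (hk : ∀ (i : ι) {x y : X} (γ : Path x y), (∀ s, γ s ∈ U i) → h.val (.mk γ) = k i x - k i y)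
    (hk' : ∀ (i : ι) {x y : X} (γ : Path x y), (∀ s, γ s ∈ U i) → h'.val (.mk γ) = k' i x - k' i y)
    (ht : ∀ i j, ∀ x ∈ U i, x ∈ U j → k j x = k i x + t i j)
    (ht' : ∀ i j, ∀ x ∈ U i, x ∈ U j → k' j x = k' i x + t i j) :
    ∃ κ : X → M, ∀ {x y : X} (γ : Path x y), h.val (.mk γ) = h'.val (.mk γ) + (κ x - κ y) := by
  have hcov : ∀ x, ∃ i, x ∈ U i := fun x => Set.mem_iUnion.1 (hc ▸ Set.mem_univ x)
  choose idx hidx using hcov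
  -- On overlaps k and k' change by the same constants, so k_i - k'_i does not depend on i and is a
  -- global potential.
  refine ⟨fun x => k (idx x) x - k' (idx x) x, fun {x y} γ => ?_⟩
  refine path_induction hU (fun {x y} q => h.val q = h'.val q +
    ((k (idx x) x - k' (idx x) x) - (k (idx y) y - k' (idx y) y))) (fun i x y γ hγ => ?_)
    (fun q q' e e' => by rw [h.val_trans, h'.val_trans, e, e']; abel) γ fun s => ⟨_, hidx (γ s)⟩
  have h0 : x ∈ U i := by simpa using hγ 0
  have h1 : y ∈ U i := by simpa using hγ 1
  rw [hk i γ hγ, hk' i γ hγ, ht i (idx x) x h0 (hidx x), ht' i (idx x) x h0 (hidx x),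
    ht i (idx y) y h1 (hidx y), ht' i (idx y) y h1 (hidx y)]
  abel

end Holonomy

/-! ### Simplicial chains of the nerve modulo boundaries -/

section NerveChains

variable {X : Type u} {ι : Type v} [LinearOrder ι] {U : ι → Set X}

/-- An edge of the nerve. -/
def nerveEdge {i j : ι} (hij : i < j) (h : (U i ∩ U j).Nonempty) : Simplex (coverNerve U) 1 :=
  ⟨OrderEmbedding.ofStrictMono ![i, j] (by
      rw [Fin.strictMono_iff_lt_succ]
      intro k
      fin_cases k
      exact hij),
    Finset.univ_nonempty.map, by
      obtain ⟨x, hi, hj⟩ := h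
      refine ⟨x, Set.mem_iInter₂.2 fun l hl => ?_⟩
      obtain ⟨k, -, rfl⟩ := Finset.mem_map.1 hl
      fin_cases k
      exacts [hi, hj]⟩

/-- A triangle of the nerve. -/
def nerveTriangle {i j l : ι} (hij : i < j) (hjl : j < l) {x : X} (hi : x ∈ U i) (hj : x ∈ U j)
    (hl : x ∈ U l) : Simplex (coverNerve U) 2 :=
  ⟨OrderEmbedding.ofStrictMono ![i, j, l] (by
      rw [Fin.strictMono_iff_lt_succ]
      intro k
      fin_cases k
      exacts [hij, hjl]),
    Finset.univ_nonempty.map, by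
      refine ⟨x, Set.mem_iInter₂.2 fun m hm => ?_⟩
      obtain ⟨k, -, rfl⟩ := Finset.mem_map.1 hm
      fin_cases k
      exacts [hi, hj, hl]⟩

/-- A vertex of the nerve as a `0`-simplex. -/
def nerveVertex {i : ι} (h : (U i).Nonempty) : Simplex (coverNerve U) 0 :=
  ⟨OrderEmbedding.ofStrictMono ![i]
      (@Subsingleton.strictMono _ _ _ _ (inferInstanceAs (Subsingleton (Fin 1))) _),
    Finset.univ_nonempty.map, by
      obtain ⟨x, hx⟩ := h
      refine ⟨x, Set.mem_iInter₂.2 fun m hm => ?_⟩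
      obtain ⟨k, -, rfl⟩ := Finset.mem_map.1 hm
      fin_cases k
      exact hx⟩

lemma Simplex.ext_apply {K : PreAbstractSimplicialComplex ι} {n : ℕ} {s s' : Simplex K n}
    (h : ∀ k, s.1 k = s'.1 k) : s = s' :=
  Subtype.ext (RelEmbedding.ext h)

lemma nerveTriangle_face_zero {i j l : ι} (hij : i < j) (hjl : j < l) {x : X} (hi : x ∈ U i)
    (hj : x ∈ U j) (hl : x ∈ U l) :
    (nerveTriangle hij hjl hi hj hl).face 0 = nerveEdge hjl ⟨x, hj, hl⟩ :=
  Simplex.ext_apply fun k => by fin_cases k <;> rfl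

lemma nerveTriangle_face_one {i j l : ι} (hij : i < j) (hjl : j < l) {x : X} (hi : x ∈ U i)
    (hj : x ∈ U j) (hl : x ∈ U l) :
    (nerveTriangle hij hjl hi hj hl).face 1 = nerveEdge (hij.trans hjl) ⟨x, hi, hl⟩ :=
  Simplex.ext_apply fun k => by fin_cases k <;> rfl

lemma nerveTriangle_face_two {i j l : ι} (hij : i < j) (hjl : j < l) {x : X} (hi : x ∈ U i)
    (hj : x ∈ U j) (hl : x ∈ U l) :
    (nerveTriangle hij hjl hi hj hl).face 2 = nerveEdge hij ⟨x, hi, hj⟩ :=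
  Simplex.ext_apply fun k => by fin_cases k <;> rfl

lemma nerveEdge_face_zero {i j : ι} (hij : i < j) (h : (U i ∩ U j).Nonempty) :
    (nerveEdge hij h).face 0 = nerveVertex (h.mono Set.inter_subset_right) :=
  Simplex.ext_apply fun k => by fin_cases k; rfl

lemma nerveEdge_face_one {i j : ι} (hij : i < j) (h : (U i ∩ U j).Nonempty) :
    (nerveEdge hij h).face 1 = nerveVertex (h.mono Set.inter_subset_left) :=
  Simplex.ext_apply fun k => by fin_cases k; rfl

lemma Simplex.src_lt_tgt {K : PreAbstractSimplicialComplex ι} (e : Simplex K 1) :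
    e.src.val < e.tgt.val :=
  e.1.strictMono (by decide)

lemma exists_mem_of_simplex {n : ℕ} (s : Simplex (coverNerve U) n) : ∃ x, ∀ k, x ∈ U (s.1 k) := by
  obtain ⟨x, hx⟩ := s.2.2
  exact ⟨x, fun k => Set.mem_iInter₂.1 hx _ (Finset.mem_map_of_mem _ (Finset.mem_univ k))⟩

lemma nerve_inter_nonempty (e : Simplex (coverNerve U) 1) :
    (U e.src.val ∩ U e.tgt.val).Nonempty := by
  obtain ⟨x, hx⟩ := exists_mem_of_simplex e
  exact ⟨x, hx 0, hx 1⟩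

lemma nerveEdge_src_tgt (e : Simplex (coverNerve U) 1) :
    nerveEdge e.src_lt_tgt (nerve_inter_nonempty e) = e :=
  Simplex.ext_apply fun k => by fin_cases k <;> rfl

/-- An antisymmetric function on pairs of indices which is additive on increasing triples with
a common point is additive on all triples with a common point. -/
lemma add_eq_of_forall_lt {M : Type*} [AddCommGroup M] (t : ι → ι → M)
    (hself : ∀ i, t i i = 0) (hsymm : ∀ i j, t j i = -t i j) (x : X)
    (ht : ∀ i j l, i < j → j < l → x ∈ U i → x ∈ U j → x ∈ U l → t i j + t j l = t i l)
    (i j l : ι) (hi : x ∈ U i) (hj : x ∈ U j) (hl : x ∈ U l) : t i j + t j l = t i l := by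
  rcases lt_trichotomy i j with h1 | rfl | h1
  · rcases lt_trichotomy j l with h2 | rfl | h2
    · exact ht i j l h1 h2 hi hj hl
    · rw [hself, add_zero]
    · rcases lt_trichotomy i l with h3 | rfl | h3
      · rw [← ht i l j h3 h2 hi hl hj, hsymm l j]; abel
      · rw [hself, hsymm i j]; abel
      · rw [hsymm l i, hsymm l j, ← ht l i j h3 h1 hl hi hj]; abel
  · rw [hself, zero_add]
  · rcases lt_trichotomy j l with h2 | rfl | h2
    · rcases lt_trichotomy i l with h3 | rfl | h3
      · rw [hsymm j i, ← ht j i l h1 h3 hj hi hl]; abel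
      · rw [hself, hsymm j i]; abel
      · rw [hsymm j i, hsymm l i, ← ht j l i h2 h3 hj hl hi]; abel
    · rw [hself, add_zero]
    · rw [hsymm j i, hsymm l j, hsymm l i, ← ht l j i h2 h1 hl hj hi]; abel

/-- Simplicial `1`-chains modulo boundaries. -/
def SimplicialChainsModBoundaries (K : PreAbstractSimplicialComplex ι) (A : Type u)
    [AddCommGroup A] : Type (max u v) :=
  SimplicialChain K A 1 ⧸ (simplicialBoundary K A 1).range

noncomputable instance (K : PreAbstractSimplicialComplex ι) (A : Type u) [AddCommGroup A] :
    AddCommGroup (SimplicialChainsModBoundaries K A) :=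
  inferInstanceAs (AddCommGroup (SimplicialChain K A 1 ⧸ (simplicialBoundary K A 1).range))

/-- The class of a simplicial chain modulo boundaries. -/
noncomputable def simplicialChainClass (K : PreAbstractSimplicialComplex ι) (A : Type u)
    [AddCommGroup A] : SimplicialChain K A 1 →+ SimplicialChainsModBoundaries K A :=
  QuotientAddGroup.mk' _

lemma simplicialChainClass_eq_zero_iff {K : PreAbstractSimplicialComplex ι} {A : Type u}
    [AddCommGroup A] (c : SimplicialChain K A 1) :
    simplicialChainClass K A c = 0 ↔ c ∈ (simplicialBoundary K A 1).range :=
  QuotientAddGroup.eq_zero_iff c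

variable (A : Type u) [AddCommGroup A]

/-- The inclusion of simplicial homology into chains modulo boundaries. -/
noncomputable def simplicialHomologyToChains (K : PreAbstractSimplicialComplex ι) :
    SimplicialH1 K A →+ SimplicialChainsModBoundaries K A :=
  QuotientAddGroup.lift _ ((simplicialChainClass K A).comp (simplicialCycles K A).subtype)
    fun c hc => (simplicialChainClass_eq_zero_iff c.1).2 hc

lemma simplicialHomologyToChains_mk (K : PreAbstractSimplicialComplex ι)
    (c : simplicialCycles K A) :
    simplicialHomologyToChains A K (QuotientAddGroup.mk c) = simplicialChainClass K A c.1 :=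
  rfl

lemma simplicialHomologyToChains_injective (K : PreAbstractSimplicialComplex ι) :
    Function.Injective (simplicialHomologyToChains A K) := by
  refine (injective_iff_map_eq_zero _).2 fun h hh => ?_
  obtain ⟨c, rfl⟩ := QuotientAddGroup.mk_surjective h
  exact (QuotientAddGroup.eq_zero_iff c).2 ((simplicialChainClass_eq_zero_iff c.1).1 hh)

/-- The boundary map on chains modulo boundaries. -/
noncomputable def boundaryOfClass (K : PreAbstractSimplicialComplex ι) :
    SimplicialChainsModBoundaries K A →+ SimplicialChain K A 0 :=
  QuotientAddGroup.lift _ (simplicialBoundary K A 0) (by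
    rintro _ ⟨b, rfl⟩
    exact DFunLike.congr_fun (simplicialBoundary_comp K A) b)

/-- Together with injectivity this identifies simplicial homology with the kernel of the boundary on
chains modulo boundaries. -/
lemma exists_simplicialHomologyToChains_eq {K : PreAbstractSimplicialComplex ι}
    (x : SimplicialChainsModBoundaries K A) (hx : boundaryOfClass A K x = 0) :
    ∃ h, simplicialHomologyToChains A K h = x := by
  obtain ⟨c, rfl⟩ := QuotientAddGroup.mk_surjective x
  exact ⟨QuotientAddGroup.mk ⟨c, hx⟩, rfl⟩

/-- The class of an edge with coefficient modulo boundaries. -/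
noncomputable def edgeHom {K : PreAbstractSimplicialComplex ι} (e : Simplex K 1) :
    A →+ SimplicialChainsModBoundaries K A :=
  (simplicialChainClass K A).comp (Finsupp.singleAddHom e)

open Classical in
/-- The class of the oriented edge from `i` to `j`, with coefficient. -/
noncomputable def nerveTransition (U : ι → Set X) (i j : ι) :
    A →+ SimplicialChainsModBoundaries (coverNerve U) A :=
  if h : i < j ∧ (U i ∩ U j).Nonempty then edgeHom A (nerveEdge h.1 h.2)
  else if h : j < i ∧ (U j ∩ U i).Nonempty then -edgeHom A (nerveEdge h.1 h.2)
  else 0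

lemma nerveTransition_of_lt {i j : ι} (hij : i < j) (h : (U i ∩ U j).Nonempty) :
    nerveTransition A U i j = edgeHom A (nerveEdge hij h) :=
  dif_pos ⟨hij, h⟩

lemma nerveTransition_self (i : ι) : nerveTransition A U i i = 0 := by
  simp [nerveTransition]

lemma nerveTransition_symm (i j : ι) :
    nerveTransition A U j i = -nerveTransition A U i j := by
  unfold nerveTransition
  by_cases h1 : i < j ∧ (U i ∩ U j).Nonempty
  · rw [dif_neg (fun h => lt_asymm h.1 h1.1), dif_pos h1, dif_pos h1]
  · rw [dif_neg h1, dif_neg h1]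
    by_cases h2 : j < i ∧ (U j ∩ U i).Nonempty
    · rw [dif_pos h2, dif_pos h2, neg_neg]
    · rw [dif_neg h2, dif_neg h2, neg_zero]

/-- A common point of three distinct members spans a triangle of the nerve, whose boundary is the
relation wanted; signs take care of the order of the indices. -/
lemma nerveTransition_add (i j l : ι) (x : X) (hi : x ∈ U i) (hj : x ∈ U j) (hl : x ∈ U l) :
    nerveTransition A U i j + nerveTransition A U j l = nerveTransition A U i l := by
  refine add_eq_of_forall_lt _ (nerveTransition_self A) (nerveTransition_symm A) x ?_ i j l hi hj hl
  intro i j l hij hjl hi hj hl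
  rw [nerveTransition_of_lt A hij ⟨x, hi, hj⟩, nerveTransition_of_lt A hjl ⟨x, hj, hl⟩,
    nerveTransition_of_lt A (hij.trans hjl) ⟨x, hi, hl⟩]
  ext a
  rw [← sub_eq_zero]
  change simplicialChainClass _ A _ + simplicialChainClass _ A _ - simplicialChainClass _ A _ = 0
  rw [← map_add, ← map_sub, simplicialChainClass_eq_zero_iff]
  refine ⟨Finsupp.single (nerveTriangle hij hjl hi hj hl) a, ?_⟩
  rw [simplicialBoundary_one_single, nerveTriangle_face_zero, nerveTriangle_face_one,
    nerveTriangle_face_two]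
  simp only [Finsupp.singleAddHom_apply]
  abel

/-- The homomorphism on chains modulo boundaries given by an additive function of edges. -/
theorem exists_hom_of_edges {M : Type*} [AddCommGroup M] (t : ι → ι → A →+ M)
    (ht : ∀ i j l, (U i ∩ U j ∩ U l).Nonempty → t i j + t j l = t i l) :
    ∃ φ : SimplicialChainsModBoundaries (coverNerve U) A →+ M,
      ∀ i j, (U i ∩ U j).Nonempty → φ.comp (nerveTransition A U i j) = t i j := by
  let T : SimplicialChain (coverNerve U) A 1 →+ M :=
    Finsupp.liftAddHom fun e : Simplex (coverNerve U) 1 => t (e.1 0) (e.1 1)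
  have hT : ∀ e a, T (Finsupp.single e a) = t (e.1 0) (e.1 1) a := fun e a =>
    Finsupp.liftAddHom_apply_single _ e a
  have hT0 : T.comp (simplicialBoundary (coverNerve U) A 1) = 0 := by
    refine Finsupp.addHom_ext fun s a => ?_
    obtain ⟨x, hx⟩ := exists_mem_of_simplex s
    rw [AddMonoidHom.comp_apply, simplicialBoundary_one_single, map_add, map_sub, hT, hT, hT]
    have h := DFunLike.congr_fun (ht (s.1 0) (s.1 1) (s.1 2) ⟨x, ⟨hx 0, hx 1⟩, hx 2⟩) a
    change t (s.1 1) (s.1 2) a - t (s.1 0) (s.1 2) a + t (s.1 0) (s.1 1) a = 0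
    rw [← h, AddMonoidHom.add_apply]
    abel
  let φ : SimplicialChainsModBoundaries (coverNerve U) A →+ M :=
    QuotientAddGroup.lift _ T (by
      rintro _ ⟨b, rfl⟩
      exact DFunLike.congr_fun hT0 b)
  have hφ : ∀ i j, i < j → (U i ∩ U j).Nonempty → φ.comp (nerveTransition A U i j) = t i j := by
    intro i j hij h
    rw [nerveTransition_of_lt A hij h]
    ext a
    exact hT _ a
  refine ⟨φ, fun i j h => ?_⟩
  rcases lt_trichotomy i j with hij | rfl | hij
  · exact hφ i j hij h
  · have hself : t i i = 0 := by simpa using ht i i i (by simpa using h)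
    rw [nerveTransition_self, hself]
    ext
    simp
  · obtain ⟨x, hi, hj⟩ := h
    have hself : t i i = 0 := by simpa using ht i i i ⟨x, ⟨hi, hi⟩, hi⟩
    have hsymm := ht i j i ⟨x, ⟨hi, hj⟩, hi⟩
    rw [hself] at hsymm
    have h : (U i ∩ U j).Nonempty := ⟨x, hi, hj⟩
    rw [nerveTransition_symm, eq_neg_of_add_eq_zero_left hsymm,
      ← hφ j i hij (by rwa [Set.inter_comm])]
    ext
    simp

open Classical in
/-- The class of a vertex of the nerve, with coefficient. -/
noncomputable def nerveVertexHom (U : ι → Set X) (i : ι) :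
    A →+ SimplicialChain (coverNerve U) A 0 :=
  if h : (U i).Nonempty then Finsupp.singleAddHom (nerveVertex h) else 0

/-- The boundary of the nerve-valued transition cocycle is itself a coboundary of constants; this is
why the induced map sends cycles to cycles. -/
lemma boundaryOfClass_nerveTransition (i j : ι) (h : (U i ∩ U j).Nonempty) :
    (boundaryOfClass A (coverNerve U)).comp (nerveTransition A U i j) =
      nerveVertexHom A U j - nerveVertexHom A U i := by
  have key : ∀ i j, i < j → (U i ∩ U j).Nonempty →
      (boundaryOfClass A (coverNerve U)).comp (nerveTransition A U i j) =
      nerveVertexHom A U j - nerveVertexHom A U i := by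
    intro i j hij h
    rw [nerveTransition_of_lt A hij h, nerveVertexHom, nerveVertexHom,
      dif_pos (h.mono Set.inter_subset_left), dif_pos (h.mono Set.inter_subset_right)]
    refine AddMonoidHom.ext fun a => ?_
    change simplicialBoundary _ A 0 (Finsupp.single _ a) = Finsupp.single _ a - Finsupp.single _ a
    rw [simplicialBoundary_zero_single, nerveEdge_face_zero, nerveEdge_face_one]
  rcases lt_trichotomy i j with hij | rfl | hij
  · exact key i j hij h
  · rw [nerveTransition_self, sub_self]
    refine AddMonoidHom.ext fun a => ?_
    simp
  · rw [nerveTransition_symm, ← neg_sub, ← key j i hij (by rwa [Set.inter_comm])]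
    refine AddMonoidHom.ext fun a => ?_
    simp

end NerveChains

/-! ### The first homology of the nerve of a good cover -/

section GoodCover

lemma homotopic_of_mem_simplyConnected {X : Type*} [TopologicalSpace X] {S : Set X}
    [SimplyConnectedSpace S] {x y : X} (γ δ : Path x y) (hγ : ∀ s, γ s ∈ S) (hδ : ∀ s, δ s ∈ S) :
    γ.Homotopic δ := by
  have hx : x ∈ S := by simpa using hγ 0
  have hy : y ∈ S := by simpa using hγ 1
  let lft (ε : Path x y) (hε : ∀ s, ε s ∈ S) : Path (⟨x, hx⟩ : S) ⟨y, hy⟩ :=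
    { toFun := fun s => ⟨ε s, hε s⟩
      continuous_toFun := ε.continuous.subtype_mk _
      source' := Subtype.ext ε.source
      target' := Subtype.ext ε.target }
  exact (SimplyConnectedSpace.paths_homotopic (lft γ hγ) (lft δ hδ)).map ⟨_, continuous_subtype_val⟩

variable {X : Type u} [TopologicalSpace X] {ι : Type v} {U : ι → Set X}

namespace IsGoodCover

lemma simplyConnectedSpace (hU : IsGoodCover U) (i : ι) (h : (U i).Nonempty) :
    SimplyConnectedSpace ↥(U i) := by
  have e : ⋂ j ∈ ({i} : Finset ι), U j = U i := by simp
  have := hU.contractible {i} (Finset.singleton_nonempty i) (by rwa [e])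
  rw [e] at this
  infer_instance

lemma isPathConnected_inter (hU : IsGoodCover U) (i j : ι) (h : (U i ∩ U j).Nonempty) :
    IsPathConnected (U i ∩ U j) := by
  classical
  have e : ⋂ l ∈ ({i, j} : Finset ι), U l = U i ∩ U j := by
    ext
    simp
  have := hU.contractible {i, j} (Finset.insert_nonempty _ _) (by rwa [e])
  rw [e] at this
  exact isPathConnected_iff_pathConnectedSpace.2 inferInstance

variable (A : Type u) [AddCommGroup A]

/-- Take for k(x) the class of a path in U_i from x to a fixed base point. Simple connectedness of
U_i makes γ followed by the path from y homotopic to the path from x. -/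
lemma exists_local_potential (hU : IsGoodCover U) (i : ι) :
    ∃ k : X → A →+ ChainsModBoundaries X A, ∀ {x y : X} (γ : Path x y), (∀ s, γ s ∈ U i) →
      (universalCocycle X A).val (.mk γ) = k x - k y := by
  rcases (U i).eq_empty_or_nonempty with h | h
  · exact ⟨0, fun γ hγ => (Set.eq_empty_iff_forall_notMem.1 h _ (hγ 0)).elim⟩
  · have := hU.simplyConnectedSpace i h
    obtain ⟨b, hb⟩ := h
    have hj : ∀ x ∈ U i, JoinedIn (U i) x b := fun x hx =>
      (isPathConnected_iff_pathConnectedSpace.2 inferInstance : IsPathConnected (U i)).joinedIn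
        x hx b hb
    classical
    refine ⟨fun x => if hx : x ∈ U i then (universalCocycle X A).val (.mk (hj x hx).somePath)
      else 0, fun {x y} γ hγ => ?_⟩
    have hx : x ∈ U i := by simpa using hγ 0
    have hy : y ∈ U i := by simpa using hγ 1
    beta_reduce
    rw [dif_pos hx, dif_pos hy, eq_sub_iff_add_eq, ← PathCocycle.val_trans,
      ← Path.Homotopic.Quotient.mk_trans]
    congr 1
    refine Path.Homotopic.Quotient.eq.2 (homotopic_of_mem_simplyConnected (S := U i) _ _ ?_
      (hj x hx).somePath_mem)
    intro s
    rw [Path.trans_apply]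
    split_ifs
    exacts [hγ _, (hj y hy).somePath_mem _]

lemma exists_realisation [LinearOrder ι] (hU : IsGoodCover U) :
    ∃ (r : Vertex (coverNerve U) → X) (_ : ∀ i, r i ∈ U i.val)
      (γ : ∀ e : Simplex (coverNerve U) 1, Path (r e.src) (r e.tgt)),
      ∀ e s, γ e s ∈ U e.src.val ∪ U e.tgt.val := by
  have hne : ∀ i : Vertex (coverNerve U), (U i.val).Nonempty := fun i => by
    simpa using i.mem.2
  have hpc : ∀ i : Vertex (coverNerve U), IsPathConnected (U i.val) := fun i => by
    have := hU.simplyConnectedSpace i.val (hne i)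
    exact isPathConnected_iff_pathConnectedSpace.2 inferInstance
  choose r hr using hne
  have hj : ∀ e : Simplex (coverNerve U) 1,
      JoinedIn (U e.src.val ∪ U e.tgt.val) (r e.src) (r e.tgt) := fun e =>
    ((hpc e.src).union (hpc e.tgt) (nerve_inter_nonempty e)).joinedIn _ (.inl (hr _)) _
      (.inr (hr _))
  exact ⟨r, hr, fun e => (hj e).somePath, fun e => (hj e).somePath_mem⟩

/-- The first homology of a space with a good cover is that of the nerve. -/
theorem exists_nerve_homology_equiv [LinearOrder ι] (hU : IsGoodCover U) :
    ∃ Φ : SimplicialH1 (coverNerve U) A ≃+ SingularH1 X A,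
      ∀ (r : Vertex (coverNerve U) → X) (_ : ∀ i, r i ∈ U i.val)
        (γ : ∀ e : Simplex (coverNerve U) 1, Path (r e.src) (r e.tgt))
        (_ : ∀ e s, γ e s ∈ U e.src.val ∪ U e.tgt.val)
        (c : simplicialCycles (coverNerve U) A),
        Represents (c.1.mapDomain fun e => Singular1.ofPath (γ e))
          (Φ (QuotientAddGroup.mk c)) := by
  obtain ⟨hol, k, hk, hkt⟩ := exists_pathCocycle_of_transition hU.isOpen hU.iUnion_eq
    (nerveTransition A U) (nerveTransition_add A)
  choose d hd using hU.exists_local_potential A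
  -- Along a path inside U_i ∩ U_j both potentials compute the same value, so d_j - d_i is constant
  -- on this path connected set.
  have hdconst : ∀ i j, ∃ T : A →+ ChainsModBoundaries X A, ∀ x ∈ U i, x ∈ U j →
      d j x = d i x + T := by
    intro i j
    by_cases h : (U i ∩ U j).Nonempty
    · have hpc := hU.isPathConnected_inter i j h
      obtain ⟨z, hz⟩ := h
      refine ⟨d j z - d i z, fun x hi hj => ?_⟩
      have hp := hpc.joinedIn x ⟨hi, hj⟩ z hz
      have h1 := hd i hp.somePath fun s => (hp.somePath_mem s).1
      rw [hd j hp.somePath fun s => (hp.somePath_mem s).2] at h1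
      rw [← sub_eq_zero] at h1 ⊢
      rw [← h1]
      abel
    · exact ⟨0, fun x hi hj => (h ⟨x, hi, hj⟩).elim⟩
  choose T hT using hdconst
  obtain ⟨φ, hφ⟩ := exists_hom_of_edges (U := U) A T (by
    rintro i j l ⟨x, ⟨hi, hj⟩, hl⟩
    have h1 := hT i l x hi hl
    rw [hT j l x hj hl, hT i j x hi hj, add_assoc] at h1
    exact add_left_cancel h1)
  -- The cocycle φ ∘ `hol` has the same transition constants T as the universal cocycle, so φ
  -- inverts `hol.lift` on cycles.
  have hback : ∀ c, singularBoundary X A 0 c = 0 →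
      φ (hol.lift (chainClass X A c)) = chainClass X A c := by
    obtain ⟨κ, hκ⟩ := exists_potential_of_transition_eq hU.isOpen hU.iUnion_eq T
      (hol.postcomp φ) (universalCocycle X A) (fun i x => φ.comp (k i x)) d
      (fun i x y γ hγ => by
        change φ.comp (hol.val (.mk γ)) = _
        rw [hk i γ hγ]
        ext a
        simp)
      (fun i x y γ hγ => hd i γ hγ)
      (fun i j x hi hj => by
        rw [hkt i j x hi hj, ← hφ i j ⟨x, hi, hj⟩]
        ext a
        simp) hT
    intro c hc
    rw [← PathCocycle.lift_postcomp, PathCocycle.lift_eq_of_potential _ _ κ hκ c hc,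
      PathCocycle.lift_universalCocycle]
  -- The boundary of `hol` is compared with the zero cocycle, for which the constant functions v_i
  -- are also local potentials, with differences v_j - v_i.
  have hbdry : ∀ c, singularBoundary X A 0 c = 0 →
      boundaryOfClass A (coverNerve U) (hol.lift (chainClass X A c)) = 0 := by
    let zero : PathCocycle X (A →+ SimplicialChain (coverNerve U) A 0) :=
      ⟨fun _ => 0, fun _ _ => (add_zero 0).symm⟩
    obtain ⟨κ, hκ⟩ := exists_potential_of_transition_eq hU.isOpen hU.iUnion_eq
      (fun i j => nerveVertexHom A U j - nerveVertexHom A U i)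
      (hol.postcomp (boundaryOfClass A (coverNerve U))) zero
      (fun i x => (boundaryOfClass A (coverNerve U)).comp (k i x)) (fun i _ => nerveVertexHom A U i)
      (fun i x y γ hγ => by
        change (boundaryOfClass A (coverNerve U)).comp (hol.val (.mk γ)) = _
        rw [hk i γ hγ]
        ext a : 1
        simp)
      (fun i x y γ hγ => (sub_self _).symm)
      (fun i j x hi hj => by
        rw [hkt i j x hi hj, ← boundaryOfClass_nerveTransition A i j ⟨x, hi, hj⟩]
        ext a : 1
        simp) (fun i j x hi hj => by abel)
    intro c hc
    rw [← PathCocycle.lift_postcomp, PathCocycle.lift_eq_of_potential _ _ κ hκ c hc,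
      PathCocycle.lift_mk]
    exact Finset.sum_eq_zero fun _ _ => rfl
  have hreal : ∀ (r : Vertex (coverNerve U) → X) (_ : ∀ i, r i ∈ U i.val)
      (γ : ∀ e : Simplex (coverNerve U) 1, Path (r e.src) (r e.tgt))
      (_ : ∀ e s, γ e s ∈ U e.src.val ∪ U e.tgt.val) (c : simplicialCycles (coverNerve U) A),
      hol.lift (chainClass X A (c.1.mapDomain fun e => Singular1.ofPath (γ e))) =
        simplicialChainClass (coverNerve U) A c.1 := by
    intro r hr γ hγ c
    rw [hol.lift_mapDomain_ofPath hU.isOpen k (edgeHom A) hk (fun e x hx hx' => by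
      rw [hkt _ _ x hx hx', nerveTransition_of_lt A e.src_lt_tgt ⟨x, hx, hx'⟩, nerveEdge_src_tgt])
      r hr γ hγ c]
    refine (map_finsuppSum (simplicialChainClass (coverNerve U) A) c.1
      fun e a => Finsupp.single e a).symm.trans ?_
    rw [Finsupp.sum_single]
  let ψ : SingularH1 X A →+ SimplicialChainsModBoundaries (coverNerve U) A :=
    hol.lift.comp (homologyToChains X A)
  have hψ : ∀ {c h}, Represents c h → ψ h = hol.lift (chainClass X A c) := fun hc =>
    congrArg hol.lift hc.homologyToChains_eq
  have hψinj : Function.Injective ψ := by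
    refine Function.Injective.of_comp (f := φ) ?_
    convert homologyToChains_injective (X := X) (A := A) using 1
    funext h
    obtain ⟨c, hc⟩ := Represents.exists_chain h
    rw [hc.homologyToChains_eq, Function.comp_apply, hψ hc, hback c hc.boundary_eq_zero]
  have hlift : ∀ h, ∃ z, simplicialHomologyToChains A (coverNerve U) z = ψ h := by
    intro h
    obtain ⟨c, hc⟩ := Represents.exists_chain h
    rw [hψ hc]
    exact exists_simplicialHomologyToChains_eq A _ (hbdry c hc.boundary_eq_zero)
  have hinjN := simplicialHomologyToChains_injective A (coverNerve U)
  choose θ hθ using hlift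
  -- Θ is defined without reference to a realisation and sends every realised cycle to its
  -- simplicial class. Its inverse Φ therefore satisfies the formula for all choices of points and
  -- paths.
  let Θ : SingularH1 X A →+ SimplicialH1 (coverNerve U) A :=
    AddMonoidHom.mk' θ fun h h' => hinjN (by rw [map_add, hθ, hθ, hθ, map_add])
  have hrep : ∀ (r : Vertex (coverNerve U) → X) (_ : ∀ i, r i ∈ U i.val)
      (γ : ∀ e : Simplex (coverNerve U) 1, Path (r e.src) (r e.tgt))
      (_ : ∀ e s, γ e s ∈ U e.src.val ∪ U e.tgt.val) (c : simplicialCycles (coverNerve U) A),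
      ∃ h, Represents (c.1.mapDomain fun e => Singular1.ofPath (γ e)) h ∧
        Θ h = QuotientAddGroup.mk c := by
    intro r hr γ hγ c
    obtain ⟨h, hh⟩ := Represents.exists_of_boundary_eq_zero _
      (singularBoundary_mapDomain_ofPath r γ c)
    refine ⟨h, hh, hinjN ?_⟩
    rw [simplicialHomologyToChains_mk, ← hreal r hr γ hγ c, ← hψ hh]
    exact hθ h
  have hΘinj : Function.Injective Θ := fun h h' e => hψinj (by
    rw [← hθ h, ← hθ h']
    exact congrArg _ e)
  obtain ⟨r, hr, γ, hγ⟩ := hU.exists_realisation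
  have hΘsurj : Function.Surjective Θ := by
    intro z
    obtain ⟨c, rfl⟩ := QuotientAddGroup.mk_surjective z
    obtain ⟨h, -, hh⟩ := hrep r hr γ hγ c
    exact ⟨h, hh⟩
  let e := AddEquiv.ofBijective Θ ⟨hΘinj, hΘsurj⟩
  refine ⟨e.symm, fun r hr γ hγ c => ?_⟩
  obtain ⟨h, h1, h2⟩ := hrep r hr γ hγ c
  rwa [← h2, show e.symm (Θ h) = h from e.symm_apply_apply h]

end IsGoodCover

end GoodCover

/-! ### Monodromy of induced coverings -/

section InducedMonodromy

variable {X Y : Type u} [TopologicalSpace X] [TopologicalSpace Y] {ι : Type v}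
  {U : ι → Set X} {E : Type*} [TopologicalSpace E] {Γ : Type w} [Group Γ] [TopologicalSpace Γ]
  [MulAction Γ E] {p : E → Y} (hp : IsQuotientCoveringMap p Γ) (f : C(X, Y))
  (φ : EquivariantAtlas Γ (InducedCovering.proj hp f) U) (l : Y → E) (hl : ∀ y, p (l y) = y)

/-- The point of the induced covering over `x` given by a section. -/
def InducedCovering.sectionPoint (x : X) : InducedCovering hp f :=
  ⟨(x, l (f x)), (hl (f x)).symm⟩

open Classical in
/-- The coordinate in the `i`-th chart of the point over `x` given by a section. -/
noncomputable def EquivariantAtlas.sectionCoord (i : ι) (x : X) : Γ :=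
  if hx : x ∈ U i then (φ.chart i ⟨InducedCovering.sectionPoint hp f l hl x, hx⟩).2 else 1

lemma EquivariantAtlas.chart_sectionPoint (i : ι) (x : X) (hx : x ∈ U i) :
    φ.chart i ⟨InducedCovering.sectionPoint hp f l hl x, hx⟩ =
      (⟨x, hx⟩, φ.sectionCoord hp f l hl i x) := by
  refine Prod.ext (Subtype.ext (φ.chart_fst i _)) ?_
  rw [EquivariantAtlas.sectionCoord, dif_pos hx]

/-- The lift of f ∘ γ is constant in the chart, with the coordinate a of the section at x. At y the
section has coordinate b, and a = (a b⁻¹) b, so by equivariance the lift ends at (a b⁻¹) times the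
section. -/
lemma EquivariantAtlas.monodromyElt_map (i : ι) {x y : X} (γ : Path x y) (hγ : ∀ s, γ s ∈ U i) :
    monodromyElt hp l hl (.mk (γ.map f.continuous)) =
      φ.sectionCoord hp f l hl i x * (φ.sectionCoord hp f l hl i y)⁻¹ := by
  have hx : x ∈ U i := by simpa using hγ 0
  have hy : y ∈ U i := by simpa using hγ 1
  set a := φ.sectionCoord hp f l hl i x with ha
  set b := φ.sectionCoord hp f l hl i y with hb
  let z (s : unitInterval) : InducedCovering hp f := ((φ.chart i).symm (⟨γ s, hγ s⟩, a)).1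
  have hz : Continuous z := continuous_subtype_val.comp ((φ.chart i).symm.continuous.comp
    ((γ.continuous.subtype_mk _).prodMk continuous_const))
  have hz1 : ∀ s, (z s).1.1 = γ s := fun s => by
    have := φ.chart_fst i ((φ.chart i).symm (⟨γ s, hγ s⟩, a))
    rw [Homeomorph.apply_symm_apply] at this
    exact this.symm
  have hsnd : Continuous fun w : InducedCovering hp f => w.1.2 :=
    continuous_snd.comp continuous_subtype_val
  refine monodromyElt_eq hp l hl _ _ (e := (z 0).1.2) (e' := (z 1).1.2)
    ⟨⟨fun s => (z s).1.2, hsnd.comp hz⟩, rfl, rfl⟩ ?_ ?_ fun s => ?_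
  · have h : (φ.chart i).symm (⟨γ 0, hγ 0⟩, a) =
        ⟨InducedCovering.sectionPoint hp f l hl x, hx⟩ := by
      rw [Homeomorph.symm_apply_eq, EquivariantAtlas.chart_sectionPoint]
      exact Prod.ext (Subtype.ext γ.source) rfl
    exact congrArg (fun w => w.1.1.2) h
  · let w : InducedCovering hp f := (a * b⁻¹) • InducedCovering.sectionPoint hp f l hl y
    have h : (φ.chart i).symm (⟨γ 1, hγ 1⟩, a) = ⟨w, hy⟩ := by
      rw [Homeomorph.symm_apply_eq]
      refine Prod.ext (Subtype.ext (γ.target.trans (φ.chart_fst i ⟨w, hy⟩).symm)) ?_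
      rw [φ.chart_smul i (a * b⁻¹) ⟨InducedCovering.sectionPoint hp f l hl y, hy⟩ ⟨w, hy⟩ rfl,
        EquivariantAtlas.chart_sectionPoint]
      simp [← hb]
    exact congrArg (fun w => w.1.1.2) h
  · exact (z s).2.symm.trans (congrArg f (hz1 s))

/-- The transition rule applied to the point of the section over x; it says that the local
potentials of the pulled-back monodromy differ by t on overlaps. -/
lemma EquivariantAtlas.sectionCoord_mul [LinearOrder ι] {t : EdgeGroupoid (coverNerve U) ⥤ Deloop Γ}
    (ht : φ.IsTransitionHom t) (e : Simplex (coverNerve U) 1) (x : X) (hx : x ∈ U e.src.val)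
    (hx' : x ∈ U e.tgt.val) :
    φ.sectionCoord hp f l hl e.tgt.val x =
      φ.sectionCoord hp f l hl e.src.val x * Deloop.elt (t.map e.edgeClass) := by
  have h := ht e.src e.tgt (e.mem_of_subset
    (by intro x hx; simp only [Finset.mem_insert, Finset.mem_singleton] at hx
        rcases hx with rfl | rfl
        · exact Finset.mem_map.mpr ⟨0, Finset.mem_univ _, rfl⟩
        · exact Finset.mem_map.mpr ⟨1, Finset.mem_univ _, rfl⟩)
    (by simp)) x hx hx' _ (InducedCovering.sectionPoint hp f l hl x) hx hx'
    (φ.chart_sectionPoint hp f l hl _ x hx)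
  rw [φ.chart_sectionPoint hp f l hl _ x hx'] at h
  exact (Prod.ext_iff.1 h).2

end InducedMonodromy

end NerveMonodromy

open NerveMonodromy in
theorem mainTheorem1 {X Y : Type u} [TopologicalSpace X] [TopologicalSpace Y]
    {ι : Type v} [LinearOrder ι] (U : ι → Set X) (hU : IsGoodCover U)
    {E : Type*} [TopologicalSpace E] [SimplyConnectedSpace E]
    {Γ : Type w} [Group Γ] [TopologicalSpace Γ] [DiscreteTopology Γ] [MulAction Γ E]
    {p : E → Y} (hp : IsQuotientCoveringMap p Γ) (f : C(X, Y))
    (φ : EquivariantAtlas Γ (InducedCovering.proj hp f) U)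
    (t : EdgeGroupoid (coverNerve U) ⥤ Deloop Γ) (ht : φ.IsTransitionHom t)
    (A : Type u) [AddCommGroup A] :
    ∃ τ : SimplicialH1 (coverNerve U) A →+ Additive (Abelianization Γ) ⊗[ℤ] A,
      (∀ c : simplicialCycles (coverNerve U) A,
        τ (QuotientAddGroup.mk c) =
          c.1.sum fun e a => abClass (Deloop.elt (t.map e.edgeClass)) ⊗ₜ[ℤ] a) ∧
      ∃ (Φ : SimplicialH1 (coverNerve U) A ≃+ SingularH1 X A)
        (Ψ : SingularH1 Y A ≃+ Additive (Abelianization Γ) ⊗[ℤ] A),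
        (∀ (r : Vertex (coverNerve U) → X) (_ : ∀ i, r i ∈ U i.val)
          (γ : ∀ e : Simplex (coverNerve U) 1, Path (r e.src) (r e.tgt))
          (_ : ∀ e s, γ e s ∈ U e.src.val ∪ U e.tgt.val)
          (c : simplicialCycles (coverNerve U) A),
          Represents (c.1.mapDomain fun e => Singular1.ofPath (γ e))
            (Φ (QuotientAddGroup.mk c))) ∧
        (∀ (l : Y → E) (hl : ∀ y, p (l y) = y) (c : Singular1 Y →₀ A) (h : SingularH1 Y A),
          Represents c h →
            Ψ h = c.sum fun σ a =>
              abClass (monodromyElt hp l hl (Path.Homotopic.Quotient.mk σ.path)) ⊗ₜ[ℤ] a) ∧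
        ∀ h : SimplicialH1 (coverNerve U) A, τ h = Ψ ((singularH1Map A f).hom (Φ h)) := by
  obtain ⟨Φ, hΦ⟩ := hU.exists_nerve_homology_equiv A
  obtain ⟨Ψ, hΨ⟩ := exists_homology_equiv_abelianization hp A
  -- With τ defined as the composite, the factorisation holds by definition; what remains is the
  -- formula for τ on cycles, which also shows that the formula is well defined.
  refine ⟨Ψ.toAddMonoidHom.comp ((singularH1Map A f).hom.comp Φ.toAddMonoidHom), fun c => ?_,
    Φ, Ψ, hΦ, fun l hl c h hc => ?_, fun h => rfl⟩
  · obtain ⟨l, hl⟩ : ∃ l : Y → E, ∀ y, p (l y) = y := hp.surjective.hasRightInverse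
    obtain ⟨r, hr, γ, hγ⟩ := hU.exists_realisation
    change Ψ ((singularH1Map A f).hom (Φ (QuotientAddGroup.mk c))) = _
    rw [hΨ l hl, PathCocycle.lift_singularH1Map, (hΦ r hr γ hγ c).homologyToChains_eq]
    -- The class is realised by paths, and the pulled-back monodromy cocycle is evaluated through
    -- its local potentials, the abelianised chart coordinates of the section.
    refine PathCocycle.lift_mapDomain_ofPath hU.isOpen _
      (fun i x => abTensor A (φ.sectionCoord hp f l hl i x))
      (fun e => abTensor A (Deloop.elt (t.map e.edgeClass))) (fun i x y δ hδ => ?_)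
      (fun e x hx hx' => ?_) r hr γ hγ c
    · rw [PathCocycle.comap_mk, monodromyCocycle_mk, φ.monodromyElt_map hp f l hl i δ hδ,
        abTensor_mul, abTensor_inv, sub_eq_add_neg]
    · rw [φ.sectionCoord_mul hp f l hl ht e x hx hx', abTensor_mul]
  · rw [hΨ l hl, hc.homologyToChains_eq]
    rfl
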